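/- **Conventions.** Let $[0,1]_G$ be the standard Gödel algebra, i.e. $[0,1]\subseteq\mathbb R$ in the language $\wedge,\vee,\cdot,\to,0,1$ with $\wedge=\cdot=\min$, $\vee=\max$, and $a\to c=1$ if $a\le c$, $a\to c=c$ otherwise. A variety is a class of algebras axiomatized by equations, and $\mathbb V(\boldsymbol A)$ is the least variety containing $\boldsymbol A$. Gödel algebras are the members of $\mathbb V([0,1]_G)$. A rational Gödel algebra is a Gödel algebra expanded with constants $\boldsymbol c_q$ ($q\in[0,1]\cap\mathbb Q$) that validates $\boldsymbol c_p\cdot\boldsymbol c_q\approx\boldsymbol c_{\min(p,q)}$, $\boldsymbol c_p\to\boldsymbol c_q\approx\boldsymbol c_{p\to q}$ (with $p\to q$ computed in $[0,1]_G$), $\boldsymbol c_0\approx0$ and $\boldsymbol c_1\approx1$; $\mathsf{RGA}$ is the variety of these algebras. A variety is nontrivial if it has a member with more than one element. On any chain with a least element $0$ and a greatest element $1$ we use the operations $\wedge=\cdot=\min$, $\vee=\max$, and $a\to c=1$ if $a\le c$, $a\to c=c$ otherwise. For real $r\in(0,1]$, $\boldsymbol Q_r$ is the chain $([0,r)\cap\mathbb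 Q)\cup\{1\}$ with the order of $\mathbb Q$; $\boldsymbol c_q$ denotes $q$ if $q<r$ and $1$ otherwise. For $p\in[0,1)\cap\mathbb Q$ and $\gamma\in\omega+1$, $\boldsymbol Q_p^\gamma$ is the chain consisting of $[0,p]\cap\mathbb Q$ in its natural order, above it new elements $t_n$ ($n<\gamma$) ordered by their indices, and above them $1$; $\boldsymbol c_q$ denotes $q$ if $q\le p$ and $1$ otherwise. For $n\in\omega$ let $$\eta_{p,n}:=\bigvee_{0\le i<j\le n+2}\big((\boldsymbol c_p\vee x_i)\leftrightarrow(\boldsymbol c_p\vee x_j)\big),$$ where $\varphi\leftrightarrow\psi$ is $(\varphi\to\psi)\wedge(\psi\to\varphi)$. A logic is a finitary substitution invariant consequence relation on the set of formulas (terms) of this language in the variables $x_0,x_1,\dots$. Rational Gödel logic $\mathbf{RG}$ is defined by: $\Gamma\vdash\varphi$ iff, for some finite $\Delta\subseteq\Gamma$, the equations $\delta\approx1$ ($\delta\in\Delta$) entail $\varphi\approx1$ in $\mathsf{RGA}$ (that is, every assignment in a member of $\mathsf{RGA}$ sending all $\delta\in\Delta$ to $1$ sends $\varphi$ to $1$).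 An extension $\vdash'$ of $\vdash$ is a logic in the same language with $\Gamma\vdash\varphi\Rightarrow\Gamma\vdash'\varphi$; it is axiomatic if there is a set $\Sigma$ of formulas closed under substitutions with $\Gamma\vdash'\varphi\iff\Gamma\cup\Sigma\vdash\varphi$ for all $\Gamma,\varphi$. For a set $\Sigma$ of formulas, $\vdash+\Sigma$ is the axiomatic extension of $\vdash$ given by the set of all substitution instances of members of $\Sigma$. A logic is consistent if some formula is not a theorem of it. Varieties and logics are ordered by inclusion. **Theorem.** All $\boldsymbol Q_r$ and $\boldsymbol Q_p^\gamma$ are rational Gödel algebras, and the following hold. 1. Every nontrivial variety of rational Gödel algebras is $\mathbb V(\boldsymbol Q_r)$ for some $r\in(0,1]$ or $\mathbb V(\boldsymbol Q_p^\gamma)$ for some $p\in[0,1)\cap\mathbb Q$ and $\gamma\in\omega+1$. Moreover, relative to $\mathsf{RGA}$, $\mathbb V(\boldsymbol Q_r)$ is axiomatized by $\{\boldsymbol c_q\approx1:q\in[r,1]\cap\mathbb Q\}$, $\mathbb V(\boldsymbol Q_p^\omega)$ is axiomatized by $\{\boldsymbol c_q\approx1:q\in(p,1]\cap\mathbb Q\}$,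 and $\mathbb V(\boldsymbol Q_p^n)$ ($n\in\omega$) is axiomatized by $\{\boldsymbol c_q\approx1:q\in(p,1]\cap\mathbb Q\}$ together with $\eta_{p,n}\approx1$. 2. For all $r_1,r_2\in(0,1]$, $p_1,p_2\in[0,1)\cap\mathbb Q$ and $\gamma_1,\gamma_2\in\omega+1$: $\mathbb V(\boldsymbol Q_{r_1})\subseteq\mathbb V(\boldsymbol Q_{r_2})\iff r_1\le r_2$; $\mathbb V(\boldsymbol Q_{r_1})\subseteq\mathbb V(\boldsymbol Q_{p_1}^{\gamma_1})\iff r_1\le p_1$; $\mathbb V(\boldsymbol Q_{p_1}^{\gamma_1})\subseteq\mathbb V(\boldsymbol Q_{r_1})\iff p_1<r_1$; $\mathbb V(\boldsymbol Q_{p_1}^{\gamma_1})\subseteq\mathbb V(\boldsymbol Q_{p_2}^{\gamma_2})\iff p_1<p_2$ or ($p_1=p_2$ and $\gamma_1\le\gamma_2$). 3. The lattice of subvarieties of $\mathsf{RGA}$ is an uncountable chain isomorphic to the poset obtained by adding a new bottom element to the Dedekind–MacNeille completion of the lexicographic order on $([0,1)\cap\mathbb Q)\times(\omega+1)$. 4.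 Every consistent axiomatic extension of $\mathbf{RG}$ is of one of the forms $\mathbf{RG}+\{\boldsymbol c_q:q\in[r,1]\cap\mathbb Q\}$ with $r\in(0,1]$; $\mathbf{RG}_p^\omega:=\mathbf{RG}+\{\boldsymbol c_q:q\in(p,1]\cap\mathbb Q\}$ with $p\in[0,1)\cap\mathbb Q$; or $\mathbf{RG}_p^\omega+\{\eta_{p,n}\}$ with $p\in[0,1)\cap\mathbb Q$ and $n\in\omega$. The lattice of axiomatic extensions of $\mathbf{RG}$ is an uncountable chain, dually isomorphic to the poset of part 3. -/

import Mathlib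

universe u v

namespace RatGodel

/-! ### Algebras in the language of BL-algebras expanded with a set of constants -/

/-- An arbitrary algebra in the language `∧, ∨, ·, →, 0, 1` expanded with a constant symbol for
each element of `C`. No laws are imposed. -/
structure Alg (C : Type) where
  carrier : Type u
  meet : carrier → carrier → carrier
  join : carrier → carrier → carrier
  mul : carrier → carrier → carrier
  imp : carrier → carrier → carrier
  zero : carrier
  one : carrier
  const : C → carrier

/-- The reduct to the language of BL-algebras (without constants). -/
def Alg.reduct {C : Type} (A : Alg.{u} C) : Alg.{u} Empty where
  carrier := A.carrier
  meet := A.meet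
  join := A.join
  mul := A.mul
  imp := A.imp
  zero := A.zero
  one := A.one
  const := Empty.elim

/-- Formulas (= terms) over the denumerable set of variables `x₀, x₁, …`. -/
inductive Fm (C : Type) : Type
  | var : ℕ → Fm C
  | const : C → Fm C
  | zero : Fm C
  | one : Fm C
  | meet : Fm C → Fm C → Fm C
  | join : Fm C → Fm C → Fm C
  | mul : Fm C → Fm C → Fm C
  | imp : Fm C → Fm C → Fm C

/-- The value of a formula in an algebra under an assignment. -/
def Fm.eval {C : Type} (A : Alg.{u} C) (e : ℕ → A.carrier) : Fm C → A.carrier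
  | .var n => e n
  | .const c => A.const c
  | .zero => A.zero
  | .one => A.one
  | .meet s t => A.meet (s.eval A e) (t.eval A e)
  | .join s t => A.join (s.eval A e) (t.eval A e)
  | .mul s t => A.mul (s.eval A e) (t.eval A e)
  | .imp s t => A.imp (s.eval A e) (t.eval A e)

/-- Simultaneous substitution of formulas for variables. -/
def Fm.subst {C : Type} (σ : ℕ → Fm C) : Fm C → Fm C
  | .var n => σ n
  | .const c => .const c
  | .zero => .zero
  | .one => .one
  | .meet s t => .meet (s.subst σ) (t.subst σ)
  | .join s t => .join (s.subst σ) (t.subst σ)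
  | .mul s t => .mul (s.subst σ) (t.subst σ)
  | .imp s t => .imp (s.subst σ) (t.subst σ)

/-- `φ ↔ ψ` abbreviates `(φ → ψ) ∧ (ψ → φ)`. -/
def Fm.iff {C : Type} (s t : Fm C) : Fm C := .meet (.imp s t) (.imp t s)

/-- The join of a finite list of formulas (the empty join is `0`). -/
def Fm.bigJoin {C : Type} (l : List (Fm C)) : Fm C := l.foldr Fm.join Fm.zero

/-- An equation `lhs ≈ rhs`. -/
structure Equation (C : Type) where
  lhs : Fm C
  rhs : Fm C

/-- `A` validates every (universally quantified) equation of `E`. -/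
def Alg.Models {C : Type} (A : Alg.{u} C) (E : Set (Equation C)) : Prop :=
  ∀ ε ∈ E, ∀ e : ℕ → A.carrier, ε.lhs.eval A e = ε.rhs.eval A e

/-! ### Varieties -/

/-- A variety is a class of algebras axiomatized by a set of equations. -/
def IsVariety {C : Type} (K : Set (Alg.{u} C)) : Prop :=
  ∃ E : Set (Equation C), K = {A | A.Models E}

/-- The smallest variety containing `K`: the algebras that validate every set of equations
validated by all members of `K`, i.e. that lie in every equational class in which `K` is included.
The algebras of `K` may live in another universe than those of the variety. -/
def V {C : Type} (K : Set (Alg.{v} C)) : Set (Alg.{u} C) :=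
  {A | ∀ E : Set (Equation C), (∀ B ∈ K, B.Models E) → A.Models E}

theorem V_isLeast {C : Type} (K : Set (Alg.{u} C)) :
    IsLeast {W : Set (Alg.{u} C) | IsVariety W ∧ K ⊆ W} (V K) := by
  refine ⟨⟨⟨{ε | ∀ B ∈ K, B.Models {ε}}, ?_⟩, fun A hA E hE => hE A hA⟩, ?_⟩
  · ext A
    refine ⟨fun hA => hA _ fun B hB ε hε => hε B hB ε rfl, fun hA E hE ε hε => ?_⟩
    refine hA ε fun B hB δ hδ => ?_
    obtain rfl : δ = ε := hδ
    exact hE B hB δ hε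
  · rintro W ⟨⟨E, rfl⟩, hK⟩ A hA
    exact hA E fun B hB => hK hB

/-- A class of algebras is nontrivial when it has a member with more than one element. -/
def IsNontrivialClass {C : Type} (K : Set (Alg.{u} C)) : Prop :=
  ∃ A ∈ K, Nontrivial A.carrier

/-! ### Gödel chains and rational Gödel algebras -/

/-- The Gödel implication of a linear order with largest element `top`. -/
def godelImp {L : Type u} [LinearOrder L] (top a c : L) : L := if a ≤ c then top else c

/-- The Gödel chain on a linear order with least element `bot` and largest element `top`, with a
given interpretation of the constants. -/
def chainAlg {C : Type} (L : Type u) [LinearOrder L] (bot top : L) (const : C → L) :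
    Alg.{u} C where
  carrier := L
  meet := min
  join := max
  mul := min
  imp := godelImp top
  zero := bot
  one := top
  const := const

/-- The standard Gödel algebra on the real unit interval `[0, 1]`. -/
noncomputable def stdG : Alg.{0} Empty :=
  chainAlg (Set.Icc (0 : ℝ) 1) 0 1 Empty.elim

/-- The implication of the standard Gödel algebra is the residuum of the minimum t-norm. -/
theorem stdG_imp_isLUB (a c : Set.Icc (0 : ℝ) 1) :
    IsLUB {b : Set.Icc (0 : ℝ) 1 | (show Set.Icc (0 : ℝ) 1 from stdG.mul b a) ≤ c}
      (show Set.Icc (0 : ℝ) 1 from stdG.imp a c) := by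
  refine IsGreatest.isLUB ⟨?_, fun b hb => ?_⟩
  · change min (godelImp 1 a c) a ≤ c
    unfold godelImp
    split_ifs with h
    · exact (min_le_right _ _).trans h
    · exact min_le_left _ _
  · change b ≤ godelImp 1 a c
    have hb' : min b a ≤ c := hb
    unfold godelImp
    split_ifs with h
    · exact Subtype.coe_le_coe.1 b.2.2
    · exact (min_le_iff.1 hb').resolve_right h

/-- The class of Gödel algebras: the variety generated by the standard Gödel algebra. -/
def GA : Set (Alg.{u} Empty) := V {stdG}

/-- The index set `[0, 1] ∩ ℚ` of the rational constants. -/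
abbrev RatConst : Type := Set.Icc (0 : ℚ) 1

/-- The class of rational Gödel algebras: the BL-reduct is a Gödel algebra, and the bookkeeping
axioms `c_p · c_q = c_{min p q}`, `c_p → c_q = c_{p → q}`, `c_0 = 0`, `c_1 = 1` hold. -/
def RGA : Set (Alg.{u} RatConst) :=
  {A | A.reduct ∈ GA ∧
    (∀ p q : RatConst, A.mul (A.const p) (A.const q) = A.const (min p q)) ∧
    (∀ p q : RatConst, A.imp (A.const p) (A.const q) = A.const (godelImp 1 p q)) ∧
    A.const 0 = A.zero ∧ A.const 1 = A.one}

/-- The universe `([0, r) ∩ ℚ) ∪ {1}`, ordered as a subset of `ℚ`. -/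
abbrev QCarrier (r : Set.Ioc (0 : ℝ) 1) : Type :=
  {x : ℚ // (0 ≤ x ∧ (x : ℝ) < r.1) ∨ x = 1}

/-- The rational Gödel chain `Q_r`, for a real `r ∈ (0, 1]`. -/
noncomputable def Q (r : Set.Ioc (0 : ℝ) 1) : Alg.{0} RatConst :=
  chainAlg (QCarrier r)
    ⟨0, Or.inl ⟨le_refl 0, by simpa using r.2.1⟩⟩
    ⟨1, Or.inr rfl⟩
    (open Classical in fun q =>
      if h : ((q.1 : ℚ) : ℝ) < r.1 then ⟨q.1, Or.inl ⟨q.2.1, h⟩⟩ else ⟨1, Or.inr rfl⟩)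

/-- The universe of `Q_p^γ`: the rationals of `[0, p]`, then a copy `{t_n : n < γ}` of the ordinal
`γ ∈ ω + 1` above them (here `ω + 1` is `ℕ∞`), then the new top element `1` (here `⊤`). -/
abbrev QQCarrier (p : Set.Ico (0 : ℚ) 1) (γ : ℕ∞) : Type :=
  WithTop (Set.Icc (0 : ℚ) p.1 ⊕ₗ {n : ℕ // (n : ℕ∞) < γ})

/-- The rational Gödel chain `Q_p^γ`, for a rational `p ∈ [0, 1)` and `γ ∈ ω + 1`. -/
noncomputable def QQ (p : Set.Ico (0 : ℚ) 1) (γ : ℕ∞) : Alg.{0} RatConst :=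
  chainAlg (QQCarrier p γ)
    ((Sum.inlₗ ⟨0, le_refl 0, p.2.1⟩ : Set.Icc (0 : ℚ) p.1 ⊕ₗ {n : ℕ // (n : ℕ∞) < γ}) :
      QQCarrier p γ)
    ⊤
    (fun q =>
      if h : q.1 ≤ p.1 then
        ((Sum.inlₗ ⟨q.1, q.2.1, h⟩ : Set.Icc (0 : ℚ) p.1 ⊕ₗ {n : ℕ // (n : ℕ∞) < γ}) :
          QQCarrier p γ)
      else ⊤)

/-! ### Axioms -/

/-- The formulas `c_q` with `q ∈ [r, 1] ∩ ℚ`. -/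
def axQ (r : Set.Ioc (0 : ℝ) 1) : Set (Fm RatConst) :=
  {φ | ∃ q : RatConst, r.1 ≤ ((q.1 : ℚ) : ℝ) ∧ φ = .const q}

/-- The formulas `c_q` with `q ∈ (p, 1] ∩ ℚ`. -/
def axQQ (p : Set.Ico (0 : ℚ) 1) : Set (Fm RatConst) :=
  {φ | ∃ q : RatConst, p.1 < q.1 ∧ φ = .const q}

/-- The constant `c_p` for a rational `p ∈ [0, 1)`. -/
def cst (p : Set.Ico (0 : ℚ) 1) : Fm RatConst := .const ⟨p.1, p.2.1, p.2.2.le⟩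

/-- The formula `⋁_{0 ≤ i < j ≤ n + 2} ((c_p ∨ x_i) ↔ (c_p ∨ x_j))`. -/
def axHeight (p : Set.Ico (0 : ℚ) 1) (n : ℕ) : Fm RatConst :=
  Fm.bigJoin
    ((((List.range (n + 3)).product (List.range (n + 3))).filter (fun ij => ij.1 < ij.2)).map
      fun ij => Fm.iff (.join (cst p) (.var ij.1)) (.join (cst p) (.var ij.2)))

/-- The equations `φ ≈ 1` with `φ ∈ Γ`. -/
def eqOne (Γ : Set (Fm RatConst)) : Set (Equation RatConst) :=
  {ε | ∃ φ ∈ Γ, ε = ⟨φ, .one⟩}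

/-- The poset of subvarieties of the variety of rational Gödel algebras, ordered by inclusion. -/
abbrev Subvariety : Type (u + 1) :=
  {K : Set (Alg.{u} RatConst) // IsVariety K ∧ K ⊆ RGA}

/-- `([0, 1) ∩ ℚ) × (ω + 1)` with the lexicographic order. -/
abbrev LexPoset : Type := Set.Ico (0 : ℚ) 1 ×ₗ ℕ∞

/-! ### Logics -/

/-- A relation between sets of formulas and formulas. -/
abbrev Entailment : Type := Set (Fm RatConst) → Fm RatConst → Prop

/-- A logic: a finitary substitution invariant consequence relation. -/
structure IsLogic (L : Entailment) : Prop where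
  refl : ∀ Γ φ, φ ∈ Γ → L Γ φ
  mono : ∀ Γ Δ φ, Γ ⊆ Δ → L Γ φ → L Δ φ
  cut : ∀ Γ Δ φ, (∀ δ ∈ Δ, L Γ δ) → L Δ φ → L Γ φ
  subst : ∀ (σ : ℕ → Fm RatConst) Γ φ, L Γ φ → L (Fm.subst σ '' Γ) (φ.subst σ)
  finitary : ∀ Γ φ, L Γ φ → ∃ Δ ⊆ Γ, Δ.Finite ∧ L Δ φ

/-- Rational Gödel logic: `Γ ⊢ φ` when for some finite `Δ ⊆ Γ` the equations `δ ≈ 1` (`δ ∈ Δ`)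
entail `φ ≈ 1` relative to the class of rational Gödel algebras. -/
def RG : Entailment := fun Γ φ =>
  ∃ Δ ⊆ Γ, Δ.Finite ∧ ∀ A ∈ RGA.{u}, ∀ e : ℕ → A.carrier,
    (∀ δ ∈ Δ, δ.eval A e = A.one) → φ.eval A e = A.one

/-- `L'` is an axiomatic extension of the logic `L`: a logic in the same language for which there
is a set `S` of formulas, closed under substitutions, with `Γ ⊢' φ ↔ Γ ∪ S ⊢ φ`. -/
def IsAxiomaticExtension (L L' : Entailment) : Prop :=
  IsLogic L' ∧ (∀ Γ φ, L Γ φ → L' Γ φ) ∧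
    ∃ S : Set (Fm RatConst), (∀ (σ : ℕ → Fm RatConst), ∀ φ ∈ S, φ.subst σ ∈ S) ∧
      ∀ Γ φ, L' Γ φ ↔ L (Γ ∪ S) φ

/-- The extension of the logic `L` axiomatized relative to `L` by the formulas of `S`, all of
whose substitution instances may be used. -/
def addAxioms (L : Entailment) (S : Set (Fm RatConst)) : Entailment := fun Γ φ =>
  L (Γ ∪ {ψ | ∃ σ : ℕ → Fm RatConst, ∃ χ ∈ S, ψ = χ.subst σ}) φ

/-- A logic is consistent when some formula is not a theorem. -/
def IsConsistent (L : Entailment) : Prop := ∃ φ, ¬ L ∅ φ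

/-- The poset of axiomatic extensions of rational Gödel logic, ordered by inclusion. -/
abbrev AxExtension : Type := {L : Entailment // IsAxiomaticExtension RG.{u} L}

end RatGodel

open RatGodel

namespace RatGodel

/-! ### Homomorphisms and failing equations -/

/-! A variety is determined by the equations that fail in it, and failures can be traced to chains.
A prime ideal of the Heyting reduct separates two given elements of a rational Gödel algebra in a
quotient that is a chain (`exists_ratChain_quotient`), so an equation failing in a subvariety fails
in a chain of it. In such a chain the constants increase strictly until they reach 1 and equal 1
from then on (`IsRatChain.const_lt`).

The operations of a Gödel chain return one of their arguments or 1. A failing equation therefore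
involves finitely many elements only, and a partial order embedding defined on these, preserving 0,
1 and the constants that occur, transports the failure (`fails_of_strictMonoOn`). The rationals in
`Q r`, and those up to `p` in `QQ p γ`, are dense, so values of variables can always be fitted
between constants there. What remains visible is which constants differ from 1 and, if there is a
last such constant `c_p`, how many elements lie strictly between `c_p` and 1. The formula `axHeight
p n` bounds that number by pigeonhole (`models_axHeight_iff`).

Upper bounds for a variety come from `IsRatChain.fails_Q` and `IsRatChain.fails_QQ`, lower bounds
from `exists_const_of_fails_Q` and `exists_card_of_fails_QQ`. For a nontrivial subvariety `K`, the
rationals `q` for which `c_q ≈ 1` fails in `K` form a down-set of `[0, 1)`. Without a maximum it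
gives `Q r`, with `r` its supremum; with maximum `p` it gives `QQ p γ`, where `γ` is the least `n`
such that `axHeight p n` is valid in `K`, or `ω`.

In the resulting chain of varieties, each rational `p > 0` contributes `Q p` followed by the `QQ p
γ`, which is a copy of `ω + 1`; for `p = 0` there are only the `QQ 0 γ`. The remaining nontrivial
varieties, given by `Q r` with `r` irrational or `r = 1`, fill the gaps of the lexicographic order.
Finally, a Lindenbaum algebra shows that an axiomatic extension is determined by the algebras
validating its theorems, and `s ≈ t` is expressed by the formula `s ↔ t`, so extensions and
subvarieties are dually isomorphic. -/

/-- Homomorphisms of algebras. -/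
structure IsHom {C : Type} (A : Alg.{u} C) (B : Alg.{v} C) (h : A.carrier → B.carrier) : Prop where
  meet : ∀ x y, h (A.meet x y) = B.meet (h x) (h y)
  join : ∀ x y, h (A.join x y) = B.join (h x) (h y)
  mul : ∀ x y, h (A.mul x y) = B.mul (h x) (h y)
  imp : ∀ x y, h (A.imp x y) = B.imp (h x) (h y)
  zero : h A.zero = B.zero
  one : h A.one = B.one
  const : ∀ c, h (A.const c) = B.const c

theorem IsHom.eval {C : Type} {A : Alg.{u} C} {B : Alg.{v} C} {h : A.carrier → B.carrier}
    (hh : IsHom A B h) (e : ℕ → A.carrier) (φ : Fm C) :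
    h (φ.eval A e) = φ.eval B (fun n => h (e n)) := by
  induction φ with
  | var n => rfl
  | const c => exact hh.const c
  | zero => exact hh.zero
  | one => exact hh.one
  | meet s t hs ht => simp only [Fm.eval, hh.meet, hs, ht]
  | join s t hs ht => simp only [Fm.eval, hh.join, hs, ht]
  | mul s t hs ht => simp only [Fm.eval, hh.mul, hs, ht]
  | imp s t hs ht => simp only [Fm.eval, hh.imp, hs, ht]

/-- The single equation `ε` fails in `A`. -/
def Fails {C : Type} (A : Alg.{u} C) (ε : Equation C) : Prop :=
  ∃ e : ℕ → A.carrier, ε.lhs.eval A e ≠ ε.rhs.eval A e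

theorem models_iff_not_fails {C : Type} {A : Alg.{u} C} {E : Set (Equation C)} :
    A.Models E ↔ ∀ ε ∈ E, ¬ Fails A ε := by
  simp only [Alg.Models, Fails, not_exists, not_not]

theorem IsHom.fails_of_surjective {C : Type} {A : Alg.{u} C} {B : Alg.{v} C}
    {h : A.carrier → B.carrier} (hh : IsHom A B h) (hs : Function.Surjective h) {ε : Equation C}
    (hε : Fails B ε) : Fails A ε := by
  obtain ⟨e, he⟩ := hε
  choose g hg using hs
  refine ⟨fun n => g (e n), fun heq => he ?_⟩
  have := congrArg h heq
  simpa only [hh.eval, hg] using this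

theorem IsHom.models_of_surjective {C : Type} {A : Alg.{u} C} {B : Alg.{v} C}
    {h : A.carrier → B.carrier} (hh : IsHom A B h) (hs : Function.Surjective h)
    {E : Set (Equation C)} (hA : A.Models E) : B.Models E := by
  rw [models_iff_not_fails] at *
  exact fun ε hε hf => hA ε hε (hh.fails_of_surjective hs hf)

/-- Sets of equations can be tested one equation at a time. All later comparisons of varieties use
this contrapositive form: failures are witnessed by one assignment and can be carried along maps. -/
theorem mem_V_iff {C : Type} {K : Set (Alg.{v} C)} {A : Alg.{u} C} :
    A ∈ V K ↔ ∀ ε, Fails A ε → ∃ B ∈ K, Fails B ε := by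
  constructor
  · intro hA ε hε
    by_contra! hcon
    refine models_iff_not_fails.1 (hA {ε} fun B hB => models_iff_not_fails.2 ?_) ε rfl hε
    rintro δ rfl
    exact hcon B hB
  · intro h E hE
    refine models_iff_not_fails.2 fun ε hε hf => ?_
    obtain ⟨B, hB, hBf⟩ := h ε hf
    exact models_iff_not_fails.1 (hE B hB) ε hε hBf

theorem mem_V_singleton {C : Type} {B : Alg.{v} C} {A : Alg.{u} C} :
    A ∈ V {B} ↔ ∀ ε, Fails A ε → Fails B ε := by
  simp [mem_V_iff]

theorem isVariety_V {C : Type} (K : Set (Alg.{v} C)) : IsVariety (V K : Set (Alg.{u} C)) := by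
  refine ⟨{ε | ∀ B ∈ K, B.Models {ε}}, ?_⟩
  ext A
  refine ⟨fun hA => hA _ fun B hB ε hε => hε B hB ε rfl, fun hA E hE ε hε => ?_⟩
  refine hA ε fun B hB δ hδ => ?_
  obtain rfl : δ = ε := hδ
  exact hE B hB δ hε

/-- A copy of an algebra in a larger universe. -/
def Alg.ulift {C : Type} (A : Alg.{v} C) : Alg.{max u v} C where
  carrier := ULift.{u} A.carrier
  meet x y := ⟨A.meet x.down y.down⟩
  join x y := ⟨A.join x.down y.down⟩
  mul x y := ⟨A.mul x.down y.down⟩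
  imp x y := ⟨A.imp x.down y.down⟩
  zero := ⟨A.zero⟩
  one := ⟨A.one⟩
  const c := ⟨A.const c⟩

theorem isHom_ulift_down {C : Type} (A : Alg.{v} C) :
    IsHom (Alg.ulift.{u} A) A (ULift.down : ULift.{u} A.carrier → A.carrier) :=
  ⟨fun _ _ => rfl, fun _ _ => rfl, fun _ _ => rfl, fun _ _ => rfl, rfl, rfl, fun _ => rfl⟩

theorem isHom_ulift_up {C : Type} (A : Alg.{v} C) :
    IsHom A (Alg.ulift.{u} A) (ULift.up : A.carrier → ULift.{u} A.carrier) :=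
  ⟨fun _ _ => rfl, fun _ _ => rfl, fun _ _ => rfl, fun _ _ => rfl, rfl, rfl, fun _ => rfl⟩

theorem fails_ulift {C : Type} {A : Alg.{v} C} {ε : Equation C} :
    Fails (Alg.ulift.{u} A) ε ↔ Fails A ε :=
  ⟨(isHom_ulift_up A).fails_of_surjective ULift.up_surjective,
    (isHom_ulift_down A).fails_of_surjective ULift.down_surjective⟩

/-- The generators live in universe 0 and the varieties in universe `u`, so the generator itself is
replaced by its lifted copy when the inclusion is applied to it. -/
theorem V_subset_V {C : Type} {A B : Alg.{0} C} :
    (V {A} : Set (Alg.{u} C)) ⊆ V {B} ↔ ∀ ε, Fails A ε → Fails B ε := by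
  constructor
  · intro h ε hε
    have hA : Alg.ulift.{u} A ∈ (V {A} : Set (Alg.{u} C)) :=
      mem_V_singleton.2 fun δ hδ => fails_ulift.1 hδ
    exact mem_V_singleton.1 (h hA) ε (fails_ulift.2 hε)
  · intro h D hD
    rw [mem_V_singleton] at *
    exact fun ε hε => h ε (hD ε hε)

theorem ulift_mem_V {C : Type} {A : Alg.{0} C} : Alg.ulift.{u} A ∈ (V {A} : Set (Alg.{u} C)) :=
  mem_V_singleton.2 fun _ hδ => fails_ulift.1 hδ

/-! ### Gödel chains -/

/-- The variables of a formula. -/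
def Fm.vars {C : Type} : Fm C → Set ℕ
  | .var n => {n}
  | .const _ => ∅
  | .zero => ∅
  | .one => ∅
  | .meet s t => s.vars ∪ t.vars
  | .join s t => s.vars ∪ t.vars
  | .mul s t => s.vars ∪ t.vars
  | .imp s t => s.vars ∪ t.vars

/-- The constants of a formula. -/
def Fm.consts {C : Type} : Fm C → Set C
  | .var _ => ∅
  | .const c => {c}
  | .zero => ∅
  | .one => ∅
  | .meet s t => s.consts ∪ t.consts
  | .join s t => s.consts ∪ t.consts
  | .mul s t => s.consts ∪ t.consts
  | .imp s t => s.consts ∪ t.consts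

theorem Fm.finite_vars {C : Type} (φ : Fm C) : φ.vars.Finite := by
  induction φ <;> simp_all [Fm.vars]

theorem Fm.finite_consts {C : Type} (φ : Fm C) : φ.consts.Finite := by
  induction φ <;> simp_all [Fm.consts]

/-- The variables of an equation. -/
def Equation.vars {C : Type} (ε : Equation C) : Set ℕ := ε.lhs.vars ∪ ε.rhs.vars

/-- The constants of an equation. -/
def Equation.consts {C : Type} (ε : Equation C) : Set C := ε.lhs.consts ∪ ε.rhs.consts

theorem Equation.finite_vars {C : Type} (ε : Equation C) : ε.vars.Finite :=
  ε.lhs.finite_vars.union ε.rhs.finite_vars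

theorem Equation.finite_consts {C : Type} (ε : Equation C) : ε.consts.Finite :=
  ε.lhs.finite_consts.union ε.rhs.finite_consts

/-! ### Finite partial embeddings between chains -/

section Chain

variable {C : Type} {L : Type u} {M : Type v} [LinearOrder L] [LinearOrder M]
  {bot top : L} {const : C → L} {bot' top' : M} {const' : C → M}

theorem min_mem_of_mem {S : Set L} {a b : L} (ha : a ∈ S) (hb : b ∈ S) : min a b ∈ S := by
  rcases min_choice a b with h | h <;> rwa [h]

theorem max_mem_of_mem {S : Set L} {a b : L} (ha : a ∈ S) (hb : b ∈ S) : max a b ∈ S := by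
  rcases max_choice a b with h | h <;> rwa [h]

theorem godelImp_mem_of_mem {S : Set L} {a b : L} (ht : top ∈ S) (hb : b ∈ S) :
    godelImp top a b ∈ S := by
  unfold godelImp
  split_ifs <;> assumption

/-- Strictness is needed because the implication tests the order: a merely monotone map could turn
`b < a` into equality and change the result to the top. -/
theorem godelImp_map {S : Set L} {h : L → M} (hS : StrictMonoOn h S) (ht : h top = top') {a b : L}
    (ha : a ∈ S) (hb : b ∈ S) : h (godelImp top a b) = godelImp top' (h a) (h b) := by
  unfold godelImp
  simp only [hS.le_iff_le ha hb]
  split_ifs <;> simp [ht]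

/-- A map that is strictly monotone on a set containing everything relevant for `φ` commutes with
the evaluation of `φ`. -/
theorem eval_of_strictMonoOn {S : Set L} {h : L → M} (hS : StrictMonoOn h S)
    (hbS : bot ∈ S) (htS : top ∈ S) (hb : h bot = bot') (ht : h top = top') (e : ℕ → L) (φ : Fm C)
    (hc : ∀ c ∈ φ.consts, const c ∈ S ∧ h (const c) = const' c) (hv : ∀ n ∈ φ.vars, e n ∈ S) :
    (show L from φ.eval (chainAlg L bot top const) e) ∈ S ∧
      h (φ.eval (chainAlg L bot top const) e) =
        φ.eval (chainAlg M bot' top' const') (fun n => h (e n)) := by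
  induction φ with
  | var n => exact ⟨hv n rfl, rfl⟩
  | const c => exact hc c rfl
  | zero => exact ⟨hbS, hb⟩
  | one => exact ⟨htS, ht⟩
  | meet s t hs ht' =>
    obtain ⟨h1, h2⟩ := hs (fun c h => hc c (Or.inl h)) (fun c h => hv c (Or.inl h))
    obtain ⟨h3, h4⟩ := ht' (fun c h => hc c (Or.inr h)) (fun c h => hv c (Or.inr h))
    refine ⟨min_mem_of_mem h1 h3, ?_⟩
    exact (hS.monotoneOn.map_min h1 h3).trans (congrArg₂ min h2 h4)
  | mul s t hs ht' =>
    obtain ⟨h1, h2⟩ := hs (fun c h => hc c (Or.inl h)) (fun c h => hv c (Or.inl h))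
    obtain ⟨h3, h4⟩ := ht' (fun c h => hc c (Or.inr h)) (fun c h => hv c (Or.inr h))
    refine ⟨min_mem_of_mem h1 h3, ?_⟩
    exact (hS.monotoneOn.map_min h1 h3).trans (congrArg₂ min h2 h4)
  | join s t hs ht' =>
    obtain ⟨h1, h2⟩ := hs (fun c h => hc c (Or.inl h)) (fun c h => hv c (Or.inl h))
    obtain ⟨h3, h4⟩ := ht' (fun c h => hc c (Or.inr h)) (fun c h => hv c (Or.inr h))
    refine ⟨max_mem_of_mem h1 h3, ?_⟩
    exact (hS.monotoneOn.map_max h1 h3).trans (congrArg₂ max h2 h4)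
  | imp s t hs ht' =>
    obtain ⟨h1, h2⟩ := hs (fun c h => hc c (Or.inl h)) (fun c h => hv c (Or.inl h))
    obtain ⟨h3, h4⟩ := ht' (fun c h => hc c (Or.inr h)) (fun c h => hv c (Or.inr h))
    refine ⟨godelImp_mem_of_mem htS h3, ?_⟩
    exact (godelImp_map hS ht h1 h3).trans (congrArg₂ (godelImp top') h2 h4)

/-- Both sides evaluate inside `S`, where `h` is injective, so distinct values stay distinct. Only
the constants and variables that occur in the equation are constrained. -/
theorem fails_of_strictMonoOn {S : Set L} {h : L → M} (hS : StrictMonoOn h S)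
    (hbS : bot ∈ S) (htS : top ∈ S) (hb : h bot = bot') (ht : h top = top') {e : ℕ → L}
    {ε : Equation C} (hc : ∀ c ∈ ε.consts, const c ∈ S ∧ h (const c) = const' c)
    (hv : ∀ n ∈ ε.vars, e n ∈ S)
    (hε : ε.lhs.eval (chainAlg L bot top const) e ≠ ε.rhs.eval (chainAlg L bot top const) e) :
    Fails (chainAlg M bot' top' const') ε := by
  obtain ⟨h1, h2⟩ := eval_of_strictMonoOn hS hbS htS hb ht e ε.lhs (fun c h => hc c (Or.inl h))
    (fun c h => hv c (Or.inl h))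
  obtain ⟨h3, h4⟩ := eval_of_strictMonoOn hS hbS htS hb ht e ε.rhs (fun c h => hc c (Or.inr h))
    (fun c h => hv c (Or.inr h))
  refine ⟨fun n => h (e n), fun heq => hε (hS.injOn h1 h3 ?_)⟩
  rw [h2, h4, heq]

/-- Since `S` is finite, `x` has nearest neighbours in it on both sides; a point between their
images serves as the image of `x`. Density is required only between `f lo` and `f hi`, so that
codomains dense on a segment only are covered. -/
theorem exists_strictMonoOn_insert {S : Set L} (hfin : S.Finite) {f : L → M}
    (hf : StrictMonoOn f S) {x lo hi : L} (hlo : lo ∈ S) (hhi : hi ∈ S) (hlx : lo < x)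
    (hxh : x < hi) (hd : ∀ y z, f lo ≤ y → y < z → z ≤ f hi → ∃ w, y < w ∧ w < z) :
    ∃ g : L → M, StrictMonoOn g (insert x S) ∧ Set.EqOn g f S := by
  by_cases hx : x ∈ S
  · exact ⟨f, by rwa [Set.insert_eq_of_mem hx], fun _ _ => rfl⟩
  obtain ⟨a, ⟨haS, hax⟩, ha⟩ := Set.exists_max_image (S ∩ Set.Iio x) id
    (hfin.inter_of_left _) ⟨lo, hlo, hlx⟩
  obtain ⟨b, ⟨hbS, hxb⟩, hb⟩ := Set.exists_min_image (S ∩ Set.Ioi x) id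
    (hfin.inter_of_left _) ⟨hi, hhi, hxh⟩
  obtain ⟨w, hw1, hw2⟩ := hd (f a) (f b) (hf.monotoneOn hlo haS (ha lo ⟨hlo, hlx⟩))
    (hf haS hbS (lt_trans hax hxb)) (hf.monotoneOn hbS hhi (hb hi ⟨hhi, hxh⟩))
  have hlow : ∀ y ∈ S, y < x → f y < w := fun y hy hyx =>
    (hf.monotoneOn hy haS (ha y ⟨hy, hyx⟩)).trans_lt hw1
  have hup : ∀ y ∈ S, x < y → w < f y := fun y hy hyx =>
    hw2.trans_le (hf.monotoneOn hbS hy (hb y ⟨hy, hyx⟩))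
  have hne : ∀ y ∈ S, y ≠ x := fun y hy h => hx (h ▸ hy)
  refine ⟨Function.update f x w, ?_, fun y hy => Function.update_of_ne (hne y hy) _ _⟩
  rintro y (rfl | hy) z (rfl | hz) hyz
  · exact absurd hyz (lt_irrefl _)
  · rw [Function.update_self, Function.update_of_ne (hne z hz)]
    exact hup z hz hyz
  · rw [Function.update_self, Function.update_of_ne (hne y hy)]
    exact hlow y hy hyz
  · rw [Function.update_of_ne (hne y hy), Function.update_of_ne (hne z hz)]
    exact hf hy hz hyz

theorem exists_strictMonoOn_union {S T : Set L} (hfin : S.Finite) (hT : T.Finite) {f : L → M}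
    (hf : StrictMonoOn f S)
    (H : ∀ x ∈ T, x ∈ S ∨ ∃ lo ∈ S, ∃ hi ∈ S, lo < x ∧ x < hi ∧
      ∀ y z, f lo ≤ y → y < z → z ≤ f hi → ∃ w, y < w ∧ w < z) :
    ∃ g : L → M, StrictMonoOn g (S ∪ T) ∧ Set.EqOn g f S := by
  induction T, hT using Set.Finite.induction_on with
  | empty => exact ⟨f, by simpa using hf, fun _ _ => rfl⟩
  | @insert x T _ hTf ih =>
    obtain ⟨g, hg, hgf⟩ := ih fun y hy => H y (Or.inr hy)
    rcases H x (Or.inl rfl) with hx | ⟨lo, hlo, hi, hhi, h1, h2, h3⟩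
    · refine ⟨g, ?_, hgf⟩
      rwa [Set.union_insert, Set.insert_eq_of_mem (show x ∈ S ∪ T from Or.inl hx)]
    · obtain ⟨k, hk, hkg⟩ := exists_strictMonoOn_insert (hfin.union hTf) hg
        (Or.inl hlo) (Or.inl hhi) h1 h2 (by rwa [hgf hlo, hgf hhi])
      refine ⟨k, by rwa [Set.union_insert], fun y hy => (hkg (Or.inl hy)).trans (hgf hy)⟩

end Chain

/-- Every nontrivial bounded chain satisfies the equations of the standard Gödel algebra. -/
theorem chainAlg_mem_GA {L : Type u} [LinearOrder L] {bot top : L} (hbot : ∀ x, bot ≤ x)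
    (htop : ∀ x, x ≤ top) (hne : bot ≠ top) (c : Empty → L) : chainAlg L bot top c ∈ GA := by
  refine mem_V_singleton.2 ?_
  rintro ε ⟨e, he⟩
  have hlt : bot < top := lt_of_le_of_ne (hbot _) hne
  -- Only the values at `bot` and `top` matter; density of the real interval accommodates the rest.
  let f : L → Set.Icc (0 : ℝ) 1 := fun x => if x = top then 1 else 0
  have hf : StrictMonoOn f {bot, top} := by
    rintro x (rfl | rfl) y (rfl | rfl) hxy
    · exact absurd hxy (lt_irrefl _)
    · simp [f, hne]
    · exact absurd hxy (hlt.not_gt)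
    · exact absurd hxy (lt_irrefl _)
  obtain ⟨g, hg, hgf⟩ := exists_strictMonoOn_union (S := {bot, top}) (T := e '' ε.vars)
    (Set.toFinite _) (ε.finite_vars.image e) hf (by
      intro x _
      by_cases hxb : x = bot
      · exact Or.inl (Or.inl hxb)
      by_cases hxt : x = top
      · exact Or.inl (Or.inr hxt)
      exact Or.inr ⟨bot, Or.inl rfl, top, Or.inr rfl, lt_of_le_of_ne (hbot x) (Ne.symm hxb),
        lt_of_le_of_ne (htop x) hxt, fun y z _ hyz _ => exists_between hyz⟩)
  refine fails_of_strictMonoOn hg (Or.inl (Or.inl rfl)) (Or.inl (Or.inr rfl)) ?_ ?_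
    (fun c => c.elim) (fun n hn => Or.inr ⟨n, hn, rfl⟩) he
  · rw [hgf (Or.inl rfl)]
    simp [f, hne]
  · rw [hgf (Or.inr rfl)]
    simp [f]

/-! ### Gödel algebras as Heyting algebras, and their quotient chains -/

section Laws

variable {L : Type u} [LinearOrder L] {top : L}

theorem min_godelImp (a b : L) (htop : ∀ x : L, x ≤ top) :
    min a (godelImp top a b) = min a b := by
  unfold godelImp; split_ifs with h
  · rw [min_eq_left h, min_eq_left (htop a)]
  · rfl

theorem min_godelImp_right (a b : L) (htop : ∀ x : L, x ≤ top) :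
    min (godelImp top a b) b = b := by
  unfold godelImp; split_ifs with h
  · exact min_eq_right (htop b)
  · exact min_self b

theorem godelImp_min (a b c : L) (htop : ∀ x : L, x ≤ top) :
    godelImp top a (min b c) = min (godelImp top a b) (godelImp top a c) := by
  unfold godelImp
  have := htop b
  have := htop c
  grind

theorem godelImp_self (a : L) : godelImp top a a = top := if_pos le_rfl

theorem godelImp_prelinear (a b : L) (htop : ∀ x : L, x ≤ top) :
    max (godelImp top a b) (godelImp top b a) = top := by
  unfold godelImp
  rcases le_total a b with h | h
  · rw [if_pos h, max_eq_left (htop _)]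
  · rw [if_pos h, max_eq_right (htop _)]

/-- In a quotient by a prime ideal this identity forces the implication to collapse to its
conclusion as soon as it is not the top. -/
theorem max_godelImp_godelImp (a b : L) (htop : ∀ x : L, x ≤ top) :
    max (godelImp top a b) (godelImp top (godelImp top a b) b) = top := by
  unfold godelImp
  by_cases h : a ≤ b
  · rw [if_pos h, max_eq_left (htop _)]
  · simp [h, htop]

end Laws

theorem eval_eq_of_mem_GA {A : Alg.{u} Empty} (hA : A ∈ GA) (s t : Fm Empty)
    (h : ∀ e : ℕ → Set.Icc (0 : ℝ) 1, s.eval stdG e = t.eval stdG e) (e : ℕ → A.carrier) : s.eval A e = t.eval A e :=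
  hA {⟨s, t⟩} (by rintro B rfl ε rfl; exact h) ⟨s, t⟩ rfl e

/-- The assignment of three values to the first three variables. -/
def assign {α : Type u} (x y z : α) : ℕ → α
  | 0 => x
  | 1 => y
  | _ => z

theorem stdG_le_one (x : Set.Icc (0 : ℝ) 1) : x ≤ 1 := x.2.2

theorem stdG_zero_le (x : Set.Icc (0 : ℝ) 1) : 0 ≤ x := x.2.1

section Heyting

variable {A : Alg.{u} RatConst} (hA : A.reduct ∈ GA)

local notation "x₀" => Fm.var (C := Empty) 0
local notation "x₁" => Fm.var (C := Empty) 1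
local notation "x₂" => Fm.var (C := Empty) 2

include hA

/-- The lattice reduct of a Gödel algebra. -/
abbrev godelLattice : Lattice A.carrier :=
  @Lattice.mk' _ ⟨A.join⟩ ⟨A.meet⟩
    (fun x y => eval_eq_of_mem_GA hA (.join x₀ x₁) (.join x₁ x₀)
      (fun e => max_comm (α := Set.Icc (0 : ℝ) 1) (e 0) (e 1)) (assign x y y))
    (fun x y z => eval_eq_of_mem_GA hA (.join (.join x₀ x₁) x₂) (.join x₀ (.join x₁ x₂))
      (fun e => max_assoc (α := Set.Icc (0 : ℝ) 1) (e 0) (e 1) (e 2)) (assign x y z))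
    (fun x y => eval_eq_of_mem_GA hA (.meet x₀ x₁) (.meet x₁ x₀)
      (fun e => min_comm (α := Set.Icc (0 : ℝ) 1) (e 0) (e 1)) (assign x y y))
    (fun x y z => eval_eq_of_mem_GA hA (.meet (.meet x₀ x₁) x₂) (.meet x₀ (.meet x₁ x₂))
      (fun e => min_assoc (α := Set.Icc (0 : ℝ) 1) (e 0) (e 1) (e 2)) (assign x y z))
    (fun x y => eval_eq_of_mem_GA hA (.join x₀ (.meet x₀ x₁)) x₀
      (fun e => sup_inf_self (α := Set.Icc (0 : ℝ) 1) (a := e 0) (b := e 1)) (assign x y y))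
    (fun x y => eval_eq_of_mem_GA hA (.meet x₀ (.join x₀ x₁)) x₀
      (fun e => inf_sup_self (α := Set.Icc (0 : ℝ) 1) (a := e 0) (b := e 1)) (assign x y y))

/-- The Heyting algebra on the carrier of a Gödel algebra. -/
abbrev godelHeyting : HeytingAlgebra A.carrier :=
  let _ := godelLattice hA
  { godelLattice hA with
    himp := A.imp
    top := A.one
    le_top := fun x => inf_eq_left.1 <| eval_eq_of_mem_GA hA (.meet x₀ .one) x₀
      (fun e => min_eq_left (stdG_le_one (e 0))) (assign x x x)
    bot := A.zero
    bot_le := fun x => inf_eq_left.1 <| eval_eq_of_mem_GA hA (.meet .zero x₀) .zero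
      (fun e => min_eq_left (stdG_zero_le (e 0))) (assign x x x)
    -- Residuation follows from identities checked in the standard algebra. From `a ≤ b → c` one
    -- gets `a ∧ b ≤ b ∧ (b → c) = b ∧ c`. Conversely, if `a ∧ b ≤ c`, then `a ≤ b → a = b → (a ∧ b)
    -- ≤ b → c`.
    le_himp_iff := by
      have hmp : ∀ x y, A.meet x (A.imp x y) = A.meet x y := fun x y =>
        eval_eq_of_mem_GA hA (.meet x₀ (.imp x₀ x₁)) (.meet x₀ x₁)
          (fun e => min_godelImp (e 0) (e 1) stdG_le_one) (assign x y y)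
      have hweak : ∀ x y, A.meet (A.imp x y) y = y := fun x y =>
        eval_eq_of_mem_GA hA (.meet (.imp x₀ x₁) x₁) x₁
          (fun e => min_godelImp_right (e 0) (e 1) stdG_le_one) (assign x y y)
      have hdist : ∀ x y z, A.imp x (A.meet y z) = A.meet (A.imp x y) (A.imp x z) := fun x y z =>
        eval_eq_of_mem_GA hA (.imp x₀ (.meet x₁ x₂)) (.meet (.imp x₀ x₁) (.imp x₀ x₂))
          (fun e => godelImp_min (e 0) (e 1) (e 2) stdG_le_one) (assign x y z)
      have hself : ∀ x, A.imp x x = A.one := fun x =>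
        eval_eq_of_mem_GA hA (.imp x₀ x₀) .one
          (fun e => godelImp_self (e 0)) (assign x x x)
      have hone : ∀ x, A.meet x A.one = x := fun x =>
        eval_eq_of_mem_GA hA (.meet x₀ .one) x₀
          (fun e => min_eq_left (stdG_le_one (e 0))) (assign x x x)
      intro a b c
      constructor
      · intro h
        have h1 : a ⊓ b ≤ A.meet b (A.imp b c) := le_inf inf_le_right (inf_le_left.trans h)
        rw [hmp] at h1
        exact h1.trans inf_le_right
      · intro h
        have h1 : A.imp b (a ⊓ b) = A.imp b a := by
          rw [← hone (A.imp b a), ← hself b]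
          exact hdist b a b
        have h2 : a ≤ A.imp b a := inf_eq_right.1 (hweak b a)
        have h3 : A.imp b (a ⊓ b) ≤ A.imp b c := by
          exact inf_eq_left.1
            ((hdist b (a ⊓ b) c).symm.trans (congrArg (A.imp b) (inf_eq_left.2 h)))
        exact h2.trans (h1.ge.trans h3)
    compl := fun x => A.imp x A.zero
    himp_bot := fun _ => rfl }

theorem godelHeyting_prelinear (x y : A.carrier) : A.join (A.imp x y) (A.imp y x) = A.one :=
  eval_eq_of_mem_GA hA (.join (.imp x₀ x₁) (.imp x₁ x₀)) .one
    (fun e => godelImp_prelinear (e 0) (e 1) stdG_le_one) (assign x y y)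

theorem godelHeyting_join_imp_imp (x y : A.carrier) :
    A.join (A.imp x y) (A.imp (A.imp x y) y) = A.one :=
  eval_eq_of_mem_GA hA (.join (.imp x₀ x₁) (.imp (.imp x₀ x₁) x₁)) .one
    (fun e => max_godelImp_godelImp (e 0) (e 1) stdG_le_one) (assign x y y)

theorem mul_eq_meet_of_mem_GA (x y : A.carrier) : A.mul x y = A.meet x y :=
  eval_eq_of_mem_GA hA (.mul x₀ x₁) (.meet x₀ x₁) (fun _ => rfl) (assign x y y)

end Heyting

theorem exists_linearOrder_quotient {α : Type u} (r : α → α → Prop) (hrefl : ∀ x, r x x)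
    (htrans : ∀ x y z, r x y → r y z → r x z) (htotal : ∀ x y, r x y ∨ r y x) :
    ∃ (L : Type u) (_ : LinearOrder L) (h : α → L), Function.Surjective h ∧
      ∀ x y, h x ≤ h y ↔ r x y := by
  classical
  let _ : Preorder α := { le := r, le_refl := hrefl, le_trans := htrans }
  have : @Std.Total α (· ≤ ·) := ⟨htotal⟩
  exact ⟨Antisymmetrization α (· ≤ ·), inferInstance, toAntisymmetrization (· ≤ ·),
    Quotient.mk_surjective, fun x y => Iff.rfl⟩

/-- The complement of a prime ideal `J` is a prime filter, and `x ⇨ y ∉ J` defines a preorder.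
Prelinearity and primeness make it total, so the quotient is a chain. Choosing `J` to contain `a`
keeps `a` apart from the top. -/
theorem exists_chain_quotient_of_heyting {H : Type u} [HeytingAlgebra H]
    (hpre : ∀ a b : H, (a ⇨ b) ⊔ (b ⇨ a) = ⊤) (himp : ∀ a b : H, (a ⇨ b) ⊔ ((a ⇨ b) ⇨ b) = ⊤)
    {a : H} (ha : a ≠ ⊤) :
    ∃ (L : Type u) (_ : LinearOrder L) (h : H → L), Function.Surjective h ∧ Monotone h ∧
      (∀ x y, h (x ⊓ y) = min (h x) (h y)) ∧ (∀ x y, h (x ⊔ y) = max (h x) (h y)) ∧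
      (∀ x y, h (x ⇨ y) = godelImp (h ⊤) (h x) (h y)) ∧ h a ≠ h ⊤ := by
  obtain ⟨J, hJ, haJ, hdisj⟩ := DistribLattice.prime_ideal_of_disjoint_filter_ideal
    (F := Order.PFilter.principal (⊤ : H)) (I := Order.Ideal.principal a) (by
      rw [Set.disjoint_left]
      intro x hx hx'
      have h1 : (⊤ : H) ≤ x := hx
      have h2 : x ≤ a := hx'
      exact ha (top_le_iff.1 (h1.trans h2)))
  have htop : (⊤ : H) ∉ J := fun h =>
    Set.disjoint_left.1 hdisj (show (⊤ : H) ∈ Order.PFilter.principal (⊤ : H) from le_rfl) h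
  have haJ' : a ∈ J := haJ (show a ∈ Order.Ideal.principal a from le_rfl)
  have hinf : ∀ x y, x ∉ J → y ∉ J → x ⊓ y ∉ J := fun x y hx hy h =>
    (hJ.mem_or_mem h).elim hx hy
  have hor : ∀ x y : H, x ⊔ y = ⊤ → x ∉ J ∨ y ∉ J := by
    intro x y hxy
    by_contra! hcon
    exact htop (hxy ▸ J.sup_mem hcon.1 hcon.2)
  have hup : ∀ x y : H, x ≤ y → x ∉ J → y ∉ J := fun x y hxy hx hy => hx (J.lower hxy hy)
  obtain ⟨L, hL, h, hsurj, hle⟩ := exists_linearOrder_quotient (fun x y : H => x ⇨ y ∉ J)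
    (fun x => by rwa [himp_self])
    (fun x y z hxy hyz => hup _ _ (himp_triangle x y z) (hinf _ _ hxy hyz))
    (fun x y => hor _ _ (hpre x y))
  have hmono : Monotone h := fun x y hxy => (hle x y).2 (by rwa [himp_eq_top_iff.2 hxy])
  have hinf' : ∀ x y, h x ≤ h y → h (x ⊓ y) = h x := fun x y hxy =>
    le_antisymm (hmono inf_le_left) ((hle _ _).2 (by
      rw [himp_inf_distrib, himp_self, top_inf_eq]; exact (hle x y).1 hxy))
  have hsup' : ∀ x y, h x ≤ h y → h (x ⊔ y) = h y := fun x y hxy =>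
    le_antisymm ((hle _ _).2 (by
      rw [sup_himp_distrib, himp_self, inf_top_eq]; exact (hle x y).1 hxy)) (hmono le_sup_right)
  refine ⟨L, hL, h, hsurj, hmono, ?_, ?_, ?_, ?_⟩
  · intro x y
    rcases le_total (h x) (h y) with hxy | hxy
    · rw [hinf' x y hxy, min_eq_left hxy]
    · rw [inf_comm, hinf' y x hxy, min_eq_right hxy]
  · intro x y
    rcases le_total (h x) (h y) with hxy | hxy
    · rw [hsup' x y hxy, max_eq_right hxy]
    · rw [sup_comm, hsup' y x hxy, max_eq_left hxy]
  · intro x y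
    unfold godelImp
    split_ifs with hxy
    · refine le_antisymm (hmono le_top) ((hle _ _).2 ?_)
      rw [top_himp]
      exact (hle x y).1 hxy
    · refine le_antisymm ((hle _ _).2 ?_) (hmono le_himp)
      -- As `x ⇨ y` lies in `J`, the other joinand `(x ⇨ y) ⇨ y` does not, so the class of `x ⇨ y`
      -- is at most that of `y`.
      exact (hor _ _ (himp x y)).resolve_left fun hcon => hxy ((hle x y).2 hcon)
  · intro heq
    have := (hle ⊤ a).1 heq.ge
    rw [top_himp] at this
    exact this haJ'

/-- Rational Gödel chains: bounded chains with constants satisfying the bookkeeping axioms. -/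
structure IsRatChain {L : Type u} [LinearOrder L] (bot top : L) (const : RatConst → L) : Prop where
  bot_le : ∀ x, bot ≤ x
  le_top : ∀ x, x ≤ top
  bot_ne_top : bot ≠ top
  const_min : ∀ p q, min (const p) (const q) = const (min p q)
  const_imp : ∀ p q, godelImp top (const p) (const q) = const (godelImp 1 p q)
  const_zero : const 0 = bot
  const_one : const 1 = top

theorem IsRatChain.mem_RGA {L : Type u} [LinearOrder L] {bot top : L} {const : RatConst → L}
    (h : IsRatChain bot top const) : chainAlg L bot top const ∈ RGA :=
  ⟨chainAlg_mem_GA h.bot_le h.le_top h.bot_ne_top _, h.const_min, h.const_imp, h.const_zero,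
    h.const_one⟩

/-- Any two elements of a rational Gödel algebra are separated by a quotient that is a chain. -/
theorem exists_ratChain_quotient {A : Alg.{u} RatConst} (hA : A ∈ RGA) {x y : A.carrier}
    (hxy : x ≠ y) :
    ∃ (L : Type u) (_ : LinearOrder L) (bot top : L) (const : RatConst → L),
      IsRatChain bot top const ∧ ∃ h : A.carrier → L, Function.Surjective h ∧
        IsHom A (chainAlg L bot top const) h ∧ h x ≠ h y := by
  obtain ⟨hG, hmin, himp, h0, h1⟩ := hA
  let _ := godelHeyting hG
  -- The equivalence of `x` and `y` is the top exactly when they are equal; a quotient keeping it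
  -- below the top separates them.
  have hne : (x ⇨ y) ⊓ (y ⇨ x) ≠ ⊤ := by
    intro h
    rw [inf_eq_top_iff, himp_eq_top_iff, himp_eq_top_iff] at h
    exact hxy (le_antisymm h.1 h.2)
  obtain ⟨L, hL, h, hsurj, hmono, hinf, hsup, himp', hsep⟩ :=
    exists_chain_quotient_of_heyting (godelHeyting_prelinear hG) (godelHeyting_join_imp_imp hG) hne
  have hle : ∀ z, z ≤ h ⊤ := fun z => by
    obtain ⟨w, rfl⟩ := hsurj z
    exact hmono le_top
  have hxy' : h x ≠ h y := by
    intro heq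
    apply hsep
    rw [hinf, himp', himp', heq]
    simp [godelImp]
  refine ⟨L, hL, h ⊥, h ⊤, fun q => h (A.const q), ⟨?_, hle, ?_, ?_, ?_, ?_, ?_⟩, h, hsurj,
    ⟨hinf, hsup, ?_, himp', rfl, rfl, fun _ => rfl⟩, hxy'⟩
  · intro z
    obtain ⟨w, rfl⟩ := hsurj z
    exact hmono bot_le
  · intro hbt
    exact hxy' (le_antisymm (((hle _).trans hbt.ge).trans (hmono bot_le))
      (((hle _).trans hbt.ge).trans (hmono bot_le)))
  · intro p q
    rw [← hinf, ← hmin, mul_eq_meet_of_mem_GA hG]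
    rfl
  · intro p q
    rw [← himp', ← himp]
    rfl
  · exact congrArg h h0
  · exact congrArg h h1
  · intro p q
    rw [mul_eq_meet_of_mem_GA hG]
    exact hinf p q

/-! ### Rational Gödel chains -/

section RatChain

variable {L : Type u} [LinearOrder L] {bot top : L} {const : RatConst → L}
  {M : Type v} [LinearOrder M] {bot' top' : M} {const' : RatConst → M}

theorem IsRatChain.const_mono (h : IsRatChain bot top const) {p q : RatConst} (hpq : p ≤ q) :
    const p ≤ const q := by
  rw [← min_eq_left_iff, h.const_min, min_eq_left hpq]

/-- For `p < q` bookkeeping gives `c_q → c_p = c_p`. If `c_q ≤ c_p`, the left side is the top, hence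
so is `c_p`. Thus constants can be identified only at the top. -/
theorem IsRatChain.const_lt (h : IsRatChain bot top const) {p q : RatConst} (hp : const p ≠ top)
    (hpq : p < q) : const p < const q := by
  by_contra hcon
  have := h.const_imp q p
  rw [godelImp, if_pos (not_lt.1 hcon), godelImp, if_neg (not_le.2 hpq)] at this
  exact hp this.symm

theorem IsRatChain.const_eq_top_of_le (h : IsRatChain bot top const) {p q : RatConst}
    (hp : const p = top) (hpq : p ≤ q) : const q = top :=
  le_antisymm (h.le_top _) (hp ▸ h.const_mono hpq)

theorem IsRatChain.const_ne_top_of_le (h : IsRatChain bot top const) {p q : RatConst}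
    (hq : const q ≠ top) (hpq : p ≤ q) : const p ≠ top :=
  fun hp => hq (h.const_eq_top_of_le hp hpq)

theorem IsRatChain.const_zero_ne_top (h : IsRatChain bot top const) : const 0 ≠ top :=
  h.const_zero ▸ h.bot_ne_top

theorem ratConst_zero_le (q : RatConst) : 0 ≤ q := q.2.1

/-- Minimum and implication depend on the order alone, so the bookkeeping axioms follow once the
constants are ordered like their indices up to collapse at the top. -/
theorem isRatChain_of_le_iff (hbot : ∀ x, bot ≤ x) (htop : ∀ x, x ≤ top) (h0 : const 0 = bot)
    (h1 : const 1 = top) (hne : bot ≠ top)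
    (hle : ∀ p q, const p ≤ const q ↔ p ≤ q ∨ const q = top) : IsRatChain bot top const := by
  have hmono : ∀ {p q}, p ≤ q → const p ≤ const q := fun h => (hle _ _).2 (Or.inl h)
  refine ⟨hbot, htop, hne, fun p q => ?_, fun p q => ?_, h0, h1⟩
  · rcases le_total p q with h | h
    · rw [min_eq_left h, min_eq_left (hmono h)]
    · rw [min_eq_right h, min_eq_right (hmono h)]
  · unfold godelImp
    by_cases hpq : p ≤ q
    · rw [if_pos hpq, if_pos (hmono hpq), h1]
    · rw [if_neg hpq]
      split_ifs with h
      · exact (((hle p q).1 h).resolve_left hpq).symm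
      · rfl

/-- Monotone maps of chains that do not identify elements except by sending them to the top are
homomorphisms. -/
theorem isHom_of_monotone {C : Type} {const : C → L} {const' : C → M} {h : L → M}
    (hlt : ∀ x y, x < y → h x < h y ∨ h x = top' ∧ h y = top')
    (htop : h top = top') (hbot : h bot = bot')
    (hc : ∀ c, h (const c) = const' c) :
    IsHom (chainAlg L bot top const) (chainAlg M bot' top' const') h := by
  have hmono : Monotone h := by
    intro x y hxy
    rcases hxy.eq_or_lt with rfl | hxy
    · exact le_rfl
    · rcases hlt x y hxy with h | ⟨h1, h2⟩
      · exact h.le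
      · rw [h1, h2]
  have himp : ∀ x y : L, h (godelImp top x y) = godelImp top' (h x) (h y) := by
    intro x y
    unfold godelImp
    by_cases h1 : x ≤ y
    · rw [if_pos h1, if_pos (hmono h1), htop]
    · rw [if_neg h1]
      split_ifs with h2
      · rcases hlt y x (not_le.1 h1) with h3 | h3
        · exact absurd h2 (not_le.2 h3)
        · exact h3.1
      · rfl
  exact ⟨fun x y => hmono.map_min, fun x y => hmono.map_max, fun x y => hmono.map_min,
    himp, hbot, htop, hc⟩

/-! ### The truth of the height axioms in chains -/

theorem max_eq_top_iff_of_le (htop : ∀ x, x ≤ top) (a b : L) :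
    max a b = top ↔ a = top ∨ b = top := by
  constructor
  · intro h
    rcases max_choice a b with h' | h'
    · exact Or.inl (h'.symm.trans h)
    · exact Or.inr (h'.symm.trans h)
  · rintro (rfl | rfl)
    · exact max_eq_left (htop _)
    · exact max_eq_right (htop _)

theorem min_godelImp_eq_top_iff (htop : ∀ x, x ≤ top) (a b : L) :
    min (godelImp top a b) (godelImp top b a) = top ↔ a = b := by
  have := htop a
  have := htop b
  unfold godelImp
  constructor
  · intro h
    by_contra hne
    rcases lt_or_gt_of_ne hne with h' | h' <;> grind
  · rintro rfl
    simp

theorem eval_bigJoin_eq_top_iff {C : Type} {const : C → L} (htop : ∀ x, x ≤ top)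
    (hne : bot ≠ top) (e : ℕ → L) (l : List (Fm C)) :
    (Fm.bigJoin l).eval (chainAlg L bot top const) e = top ↔
      ∃ φ ∈ l, φ.eval (chainAlg L bot top const) e = top := by
  induction l with
  | nil =>
    simp only [List.not_mem_nil, false_and, exists_false, iff_false]
    exact hne
  | cons φ l ih =>
    rw [List.exists_mem_cons_iff, ← ih]
    exact max_eq_top_iff_of_le htop _ _

theorem eval_iff_eq_top_iff {C : Type} {const : C → L} (htop : ∀ x, x ≤ top) (e : ℕ → L)
    (s t : Fm C) :
    (Fm.iff s t).eval (chainAlg L bot top const) e = top ↔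
      s.eval (chainAlg L bot top const) e = t.eval (chainAlg L bot top const) e :=
  min_godelImp_eq_top_iff htop _ _

/-- The rational `p ∈ [0, 1)` as an index of a constant. -/
def toRatConst (p : Set.Ico (0 : ℚ) 1) : RatConst := ⟨p.1, p.2.1, p.2.2.le⟩

theorem eval_axHeight_eq_top_iff (h : IsRatChain bot top const) (p : Set.Ico (0 : ℚ) 1) (n : ℕ)
    (e : ℕ → L) :
    (axHeight p n).eval (chainAlg L bot top const) e = top ↔
      ∃ i j, i < j ∧ j < n + 3 ∧
        max (const (toRatConst p)) (e i) = max (const (toRatConst p)) (e j) := by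
  rw [axHeight, eval_bigJoin_eq_top_iff h.le_top h.bot_ne_top]
  constructor
  · rintro ⟨φ, hφ, hφt⟩
    simp only [List.mem_map, List.mem_filter, decide_eq_true_eq] at hφ
    obtain ⟨⟨i, j⟩, ⟨hij, hlt⟩, rfl⟩ := hφ
    replace hij := List.pair_mem_product.1 hij
    rw [List.mem_range, List.mem_range] at hij
    exact ⟨i, j, hlt, hij.2, (eval_iff_eq_top_iff h.le_top e _ _).1 hφt⟩
  · rintro ⟨i, j, hlt, hj, heq⟩
    refine ⟨_, ?_, (eval_iff_eq_top_iff h.le_top e (.join (cst p) (.var i))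
      (.join (cst p) (.var j))).2 heq⟩
    simp only [List.mem_map, List.mem_filter, decide_eq_true_eq]
    exact ⟨(i, j), ⟨List.pair_mem_product.2 ⟨List.mem_range.2 (hlt.trans hj),
      List.mem_range.2 hj⟩, hlt⟩, rfl⟩

/-- Pigeonhole: the axiom says that among any `n + 3` elements of `[c_p, 1]` two coincide. The
endpoints account for two of them, which leaves at most `n` strictly inside. If `c_p` is the top,
both sides hold trivially. -/
theorem models_axHeight_iff (h : IsRatChain bot top const) (p : Set.Ico (0 : ℚ) 1) (n : ℕ) :
    ¬ Fails (chainAlg L bot top const) ⟨axHeight p n, .one⟩ ↔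
      ∀ U : Finset L, ↑U ⊆ Set.Ioo (const (toRatConst p)) top → U.card ≤ n := by
  classical
  set c := const (toRatConst p)
  have hax : ¬ Fails (chainAlg L bot top const) ⟨axHeight p n, .one⟩ ↔
      ∀ e : ℕ → L, ∃ i j, i < j ∧ j < n + 3 ∧ max c (e i) = max c (e j) := by
    simp only [Fails, not_exists, not_not]
    exact forall_congr' fun e => eval_axHeight_eq_top_iff h p n e
  rw [hax]
  constructor
  · intro hm U hU
    by_contra! hcard
    obtain ⟨u, hu⟩ : U.Nonempty := Finset.card_pos.1 (by omega)
    have hct : c < top := (hU hu).1.trans (hU hu).2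
    have hc : c ∉ U := fun hc => lt_irrefl _ (hU hc).1
    have ht : top ∉ insert c U := by
      rw [Finset.mem_insert, not_or]
      exact ⟨hct.ne', fun ht => lt_irrefl _ (hU ht).2⟩
    -- More than `n` inner elements together with both endpoints supply `n + 3` distinct values;
    -- enumerating them refutes the axiom.
    obtain ⟨W, hW, hWcard⟩ := Finset.exists_subset_card_eq (s := insert top (insert c U))
      (n := n + 3) (by
        rw [Finset.card_insert_of_notMem ht, Finset.card_insert_of_notMem hc]; omega)
    have hcW : ∀ w ∈ W, c ≤ w := by
      intro w hw
      rcases Finset.mem_insert.1 (hW hw) with rfl | hw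
      · exact h.le_top _
      rcases Finset.mem_insert.1 hw with rfl | hw
      · exact le_rfl
      · exact (hU hw).1.le
    obtain ⟨i, j, hij, hj, heq⟩ := hm fun i =>
      if hi : i < n + 3 then W.orderEmbOfFin hWcard ⟨i, hi⟩ else top
    simp only [hj, hij.trans hj, dif_pos, max_eq_right (hcW _ (W.orderEmbOfFin_mem hWcard _)),
      EmbeddingLike.apply_eq_iff_eq, Fin.mk.injEq] at heq
    exact hij.ne heq
  · intro hU e
    by_contra! hcon
    have hinj : Set.InjOn (fun i => max c (e i)) (Finset.range (n + 3) : Set ℕ) := by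
      intro i hi j hj hij
      simp only [Finset.coe_range, Set.mem_Iio] at hi hj
      rcases lt_trichotomy i j with hlt | rfl | hlt
      · exact absurd hij (hcon i j hlt hj)
      · rfl
      · exact absurd hij.symm (hcon j i hlt hi)
    have hcard := Finset.card_image_of_injOn hinj
    rw [Finset.card_range] at hcard
    have := hU ((((Finset.range (n + 3)).image fun i => max c (e i)).erase c).erase top) (by
      intro x hx
      simp only [Finset.coe_erase, Finset.coe_image, Set.mem_sdiff, Set.mem_image,
        Set.mem_singleton_iff] at hx
      obtain ⟨⟨⟨i, _, rfl⟩, hc⟩, ht⟩ := hx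
      exact ⟨lt_of_le_of_ne (le_max_left _ _) (Ne.symm hc), lt_of_le_of_ne (h.le_top _) ht⟩)
    have h1 := Finset.pred_card_le_card_erase
      (s := ((Finset.range (n + 3)).image fun i => max c (e i)).erase c) (a := top)
    have h2 := Finset.pred_card_le_card_erase
      (s := (Finset.range (n + 3)).image fun i => max c (e i)) (a := c)
    omega

/-- The partial embedding between two rational Gödel chains given by finitely many constants. -/
theorem exists_const_map (h : IsRatChain bot top const) (h' : IsRatChain bot' top' const')
    {P : Set RatConst} (hP : ∀ q ∈ P, const q = top ↔ const' q = top') :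
    ∃ f : L → M, f top = top' ∧ (∀ q ∈ P, f (const q) = const' q) ∧
      StrictMonoOn f (insert top (const '' P)) := by
  classical
  have hlt : ∀ a ∈ P, ∀ b, const a < const b → const' a < const' b := by
    intro a ha b hab
    have hat : const a ≠ top := (hab.trans_le (h.le_top _)).ne
    exact h'.const_lt (fun hh => hat ((hP a ha).2 hh)) (not_le.1 fun hh =>
      absurd (h.const_mono hh) (not_le.2 hab))
  -- The choice of index is harmless: two indices of the same element are equal unless that element
  -- is the top, where `hP` sends both to `top'`.
  let f : L → M := fun x => if hx : ∃ q ∈ P, const q = x then const' hx.choose else top'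
  have hf : ∀ q ∈ P, f (const q) = const' q := by
    intro q hq
    have hx : ∃ q' ∈ P, const q' = const q := ⟨q, hq, rfl⟩
    have hfq : f (const q) = const' hx.choose := dif_pos hx
    obtain ⟨hxP, hxe⟩ := hx.choose_spec
    rw [hfq]
    by_cases hqt : const q = top
    · rw [(hP q hq).1 hqt, (hP _ hxP).1 (hxe.trans hqt)]
    · rcases lt_trichotomy hx.choose q with hl | hl | hl
      · exact absurd hxe (h.const_lt (fun hh => hqt (hxe.symm.trans hh)) hl).ne
      · rw [hl]
      · exact absurd hxe (h.const_lt hqt hl).ne'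
  have hft : f top = top' := by
    by_cases hx : ∃ q ∈ P, const q = top
    · obtain ⟨q, hq, hqt⟩ := hx
      rw [← hqt, hf q hq, (hP q hq).1 hqt]
    · exact dif_neg hx
  refine ⟨f, hft, hf, ?_⟩
  rintro _ (rfl | ⟨a, ha, rfl⟩) _ (rfl | ⟨b, hb, rfl⟩) hab
  · exact absurd hab (lt_irrefl _)
  · exact absurd (h.le_top _) (not_le.2 hab)
  · rw [hf a ha, hft]
    exact lt_of_le_of_ne (h'.le_top _) fun hh => hab.ne ((hP a ha).2 hh)
  · rw [hf a ha, hf b hb]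
    exact hlt a ha b hab

end RatChain

/-! ### The chains `Q r` -/

/-- The least element of `Q r`. -/
def qBot (r : Set.Ioc (0 : ℝ) 1) : QCarrier r := ⟨0, Or.inl ⟨le_refl 0, by simpa using r.2.1⟩⟩

/-- The greatest element of `Q r`. -/
def qTop (r : Set.Ioc (0 : ℝ) 1) : QCarrier r := ⟨1, Or.inr rfl⟩

open Classical in
/-- The constants of `Q r`. -/
noncomputable def qConst (r : Set.Ioc (0 : ℝ) 1) (q : RatConst) : QCarrier r :=
  if h : ((q.1 : ℚ) : ℝ) < r.1 then ⟨q.1, Or.inl ⟨q.2.1, h⟩⟩ else ⟨1, Or.inr rfl⟩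

theorem qConst_of_lt {r : Set.Ioc (0 : ℝ) 1} {q : RatConst} (h : ((q.1 : ℚ) : ℝ) < r.1) :
    qConst r q = ⟨q.1, Or.inl ⟨q.2.1, h⟩⟩ := dif_pos h

theorem qConst_of_le {r : Set.Ioc (0 : ℝ) 1} {q : RatConst} (h : r.1 ≤ ((q.1 : ℚ) : ℝ)) :
    qConst r q = qTop r := dif_neg (not_lt.2 h)

theorem qConst_eq_top_iff {r : Set.Ioc (0 : ℝ) 1} {q : RatConst} :
    qConst r q = qTop r ↔ r.1 ≤ ((q.1 : ℚ) : ℝ) := by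
  refine ⟨fun h => ?_, qConst_of_le⟩
  by_contra hcon
  rw [qConst_of_lt (not_le.1 hcon)] at h
  have h1 : q.1 = 1 := congrArg Subtype.val h
  rw [h1] at hcon
  exact hcon (by simpa using r.2.2)

theorem QCarrier.nonneg {r : Set.Ioc (0 : ℝ) 1} (x : QCarrier r) : 0 ≤ x.1 := by
  rcases x.2 with h | h
  · exact h.1
  · rw [h]; norm_num

theorem QCarrier.lt_one {r : Set.Ioc (0 : ℝ) 1} {x : QCarrier r} (h : (x.1 : ℝ) < r.1) :
    x.1 < 1 := by
  have : (x.1 : ℝ) < 1 := h.trans_le r.2.2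
  exact_mod_cast this

theorem QCarrier.le_one {r : Set.Ioc (0 : ℝ) 1} (x : QCarrier r) : x.1 ≤ 1 := by
  rcases x.2 with h | h
  · exact (QCarrier.lt_one h.2).le
  · exact h.le

/-- The index of the constant denoting a given element of `Q r`. -/
def QCarrier.toRatConst {r : Set.Ioc (0 : ℝ) 1} (x : QCarrier r) : RatConst :=
  ⟨x.1, x.nonneg, x.le_one⟩

theorem qConst_toRatConst {r : Set.Ioc (0 : ℝ) 1} (x : QCarrier r) :
    qConst r x.toRatConst = x := by
  rcases x.2 with h | h
  · exact qConst_of_lt (q := x.toRatConst) h.2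
  · rw [qConst_of_le (q := x.toRatConst)]
    · exact Subtype.ext h.symm
    · change r.1 ≤ ((x.1 : ℚ) : ℝ)
      rw [h]
      simpa using r.2.2

theorem qBot_le {r : Set.Ioc (0 : ℝ) 1} (x : QCarrier r) : qBot r ≤ x := x.nonneg

theorem le_qTop {r : Set.Ioc (0 : ℝ) 1} (x : QCarrier r) : x ≤ qTop r := x.le_one

theorem qTop_of_le {r : Set.Ioc (0 : ℝ) 1} {x : QCarrier r} (h : r.1 ≤ (x.1 : ℝ)) : x = qTop r := by
  rcases x.2 with h' | h'
  · exact absurd h'.2 (not_lt.2 h)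
  · exact Subtype.ext h'

theorem isRatChain_Q (r : Set.Ioc (0 : ℝ) 1) : IsRatChain (qBot r) (qTop r) (qConst r) := by
  refine isRatChain_of_le_iff qBot_le le_qTop (qConst_of_lt (by simpa using r.2.1))
    (qConst_of_le (by simpa using r.2.2)) ?_ ?_
  · intro h
    have : (0 : ℚ) = 1 := congrArg Subtype.val h
    norm_num at this
  · intro p q
    rcases lt_or_ge ((q.1 : ℚ) : ℝ) r.1 with hq | hq
    · have hqt : qConst r q ≠ qTop r := fun h => absurd (qConst_eq_top_iff.1 h) (not_le.2 hq)
      simp only [hqt, or_false]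
      rcases lt_or_ge ((p.1 : ℚ) : ℝ) r.1 with hp | hp
      · rw [qConst_of_lt hp, qConst_of_lt hq]
        exact Iff.rfl
      · rw [qConst_of_le hp]
        constructor
        · intro h
          exact absurd (le_antisymm (le_qTop _) h) hqt
        · intro h
          have : ((p.1 : ℚ) : ℝ) ≤ q.1 := by exact_mod_cast h
          linarith
    · simp [qConst_of_le hq, le_qTop]

/-- There is no gap even just below the top, because `[0, r) ∩ ℚ` has no largest element. This is
what lets `Q r` absorb arbitrary finite configurations. -/
instance instDenselyOrderedQCarrier (r : Set.Ioc (0 : ℝ) 1) : DenselyOrdered (QCarrier r) where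
  dense a b hab := by
    have hab' : a.1 < b.1 := hab
    have har : (a.1 : ℝ) < r.1 := by
      rcases a.2 with h | h
      · exact h.2
      · rw [h] at hab'
        exact absurd b.le_one (not_le.2 hab')
    have hab'' : (a.1 : ℝ) < b.1 := by exact_mod_cast hab'
    obtain ⟨c, hac, hc⟩ := exists_rat_btwn (lt_min har hab'')
    refine ⟨⟨c, Or.inl ⟨?_, hc.trans_le (min_le_left _ _)⟩⟩, ?_, ?_⟩
    · have : a.1 < c := by exact_mod_cast hac
      exact a.nonneg.trans this.le
    · exact Subtype.coe_lt_coe.1 (by exact_mod_cast hac)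
    · exact Subtype.coe_lt_coe.1 (by exact_mod_cast hc.trans_le (min_le_right _ _))

/-- Collapsing all elements from `s` on to the top is a homomorphism of `Q r` onto `Q s`. -/
theorem fails_Q_mono {r s : Set.Ioc (0 : ℝ) 1} (hsr : s ≤ r) {ε : Equation RatConst}
    (hε : Fails (Q s) ε) : Fails (Q r) ε := by
  have hs := isRatChain_Q s
  have hsr' : s.1 ≤ r.1 := hsr
  refine (isHom_of_monotone (h := fun x : QCarrier r => qConst s x.toRatConst) ?_ ?_ ?_
    ?_ : IsHom (Q r) (Q s) _).fails_of_surjective ?_ hε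
  · intro x y hxy
    by_cases hx : qConst s x.toRatConst = qTop s
    · exact Or.inr ⟨hx, hs.const_eq_top_of_le hx hxy.le⟩
    · exact Or.inl (hs.const_lt hx hxy)
  · exact hs.const_one
  · exact hs.const_zero
  · intro q
    change qConst s (qConst r q).toRatConst = qConst s q
    rcases lt_or_ge ((q.1 : ℚ) : ℝ) r.1 with hq | hq
    · rw [qConst_of_lt hq]
      rfl
    · rw [qConst_of_le hq, qConst_of_le (hsr'.trans hq)]
      exact hs.const_one
  · intro y
    refine ⟨⟨y.1, y.2.imp_left fun h => ⟨h.1, h.2.trans_le hsr'⟩⟩, ?_⟩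
    exact qConst_toRatConst y

/-! ### The chains `QQ p γ` -/

section QQ

variable {p : Set.Ico (0 : ℚ) 1} {γ : ℕ∞}

/-- The rational elements of `QQ p γ`. -/
def qqLow (p : Set.Ico (0 : ℚ) 1) (γ : ℕ∞) (x : Set.Icc (0 : ℚ) p.1) : QQCarrier p γ :=
  ((Sum.inlₗ x : Set.Icc (0 : ℚ) p.1 ⊕ₗ {n : ℕ // (n : ℕ∞) < γ}) : QQCarrier p γ)

/-- The elements `t_n` of `QQ p γ`. -/
def qqMid (p : Set.Ico (0 : ℚ) 1) (γ : ℕ∞) (n : {n : ℕ // (n : ℕ∞) < γ}) : QQCarrier p γ :=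
  ((Sum.inrₗ n : Set.Icc (0 : ℚ) p.1 ⊕ₗ {n : ℕ // (n : ℕ∞) < γ}) : QQCarrier p γ)

theorem QQCarrier.cases {P : QQCarrier p γ → Prop} (hlow : ∀ x, P (qqLow p γ x))
    (hmid : ∀ n, P (qqMid p γ n)) (htop : P ⊤) (x : QQCarrier p γ) : P x := by
  induction x using WithTop.recTopCoe with
  | top => exact htop
  | coe z =>
    rcases h : ofLex z with a | n
    · obtain rfl : z = Sum.inlₗ a := congrArg toLex h
      exact hlow a
    · obtain rfl : z = Sum.inrₗ n := congrArg toLex h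
      exact hmid n

/-- Definition of a map on `QQ p γ` by cases. -/
def qqElim {α : Type u} (f : Set.Icc (0 : ℚ) p.1 → α) (g : {n : ℕ // (n : ℕ∞) < γ} → α) (t : α) :
    QQCarrier p γ → α :=
  WithTop.recTopCoe t fun z => Sum.elim f g (ofLex z)

section
variable {α : Type u} (f : Set.Icc (0 : ℚ) p.1 → α) (g : {n : ℕ // (n : ℕ∞) < γ} → α) (t : α)

@[simp] theorem qqElim_mid (n) : qqElim f g t (qqMid p γ n) = g n := rfl

end

@[simp] theorem qqLow_le_qqLow {x y} : qqLow p γ x ≤ qqLow p γ y ↔ x ≤ y := by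
  simp [qqLow]

@[simp] theorem qqLow_lt_qqLow {x y} : qqLow p γ x < qqLow p γ y ↔ x < y := by
  simp [qqLow]

@[simp] theorem qqMid_lt_qqMid {m n} : qqMid p γ m < qqMid p γ n ↔ m < n := by
  simp [qqMid]

@[simp] theorem qqLow_lt_qqMid (x n) : qqLow p γ x < qqMid p γ n := by
  simp [qqLow, qqMid]

@[simp] theorem not_qqMid_lt_qqLow (x n) : ¬ qqMid p γ n < qqLow p γ x :=
  (qqLow_lt_qqMid x n).not_gt

@[simp] theorem qqLow_lt_top (x) : qqLow p γ x < ⊤ := WithTop.coe_lt_top _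

@[simp] theorem qqMid_lt_top (n) : qqMid p γ n < ⊤ := WithTop.coe_lt_top _

/-- The least element of `QQ p γ`. -/
def qqBot (p : Set.Ico (0 : ℚ) 1) (γ : ℕ∞) : QQCarrier p γ := qqLow p γ ⟨0, le_refl 0, p.2.1⟩

/-- The constants of `QQ p γ`. -/
def qqConst (p : Set.Ico (0 : ℚ) 1) (γ : ℕ∞) (q : RatConst) : QQCarrier p γ :=
  if h : q.1 ≤ p.1 then qqLow p γ ⟨q.1, q.2.1, h⟩ else ⊤

theorem qqConst_of_le {q : RatConst} (h : q.1 ≤ p.1) :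
    qqConst p γ q = qqLow p γ ⟨q.1, q.2.1, h⟩ := dif_pos h

theorem qqConst_of_lt {q : RatConst} (h : p.1 < q.1) : qqConst p γ q = ⊤ := dif_neg (not_le.2 h)

theorem qqConst_eq_top_iff {q : RatConst} : qqConst p γ q = ⊤ ↔ p.1 < q.1 := by
  refine ⟨fun h => ?_, qqConst_of_lt⟩
  by_contra hcon
  rw [qqConst_of_le (not_lt.1 hcon)] at h
  exact (qqLow_lt_top _).ne h

/-- The index of the constant denoting a given rational element of `QQ p γ`. -/
def lowToRatConst (x : Set.Icc (0 : ℚ) p.1) : RatConst := ⟨x.1, x.2.1, x.2.2.trans p.2.2.le⟩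

theorem qqBot_le (x : QQCarrier p γ) : qqBot p γ ≤ x := by
  refine QQCarrier.cases (fun x => ?_) (fun n => ?_) ?_ x
  · exact qqLow_le_qqLow.2 x.2.1
  · exact (qqLow_lt_qqMid _ _).le
  · exact le_top

theorem isRatChain_QQ (p : Set.Ico (0 : ℚ) 1) (γ : ℕ∞) :
    IsRatChain (qqBot p γ) ⊤ (qqConst p γ) := by
  refine isRatChain_of_le_iff qqBot_le (fun _ => le_top) (qqConst_of_le p.2.1)
    (qqConst_of_lt p.2.2) (qqLow_lt_top _).ne ?_
  intro a b
  rcases lt_or_ge p.1 b.1 with hb | hb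
  · simp [qqConst_of_lt hb]
  · have hbt : qqConst p γ b ≠ ⊤ := fun h => absurd (qqConst_eq_top_iff.1 h) (not_lt.2 hb)
    simp only [hbt, or_false]
    rcases lt_or_ge p.1 a.1 with ha | ha
    · rw [qqConst_of_lt ha, top_le_iff]
      exact ⟨fun h => absurd h hbt, fun h => absurd (hb.trans_lt ha) (not_lt.2 h)⟩
    · rw [qqConst_of_le ha, qqConst_of_le hb, qqLow_le_qqLow]
      exact Iff.rfl

/-- `Q s` is again a quotient: everything from `s` on, including all `t_n`, collapses to the top. -/
theorem fails_QQ_of_fails_Q {s : Set.Ioc (0 : ℝ) 1} (hsp : s.1 ≤ ((p.1 : ℚ) : ℝ))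
    {ε : Equation RatConst} (hε : Fails (Q s) ε) : Fails (QQ p γ) ε := by
  have hs := isRatChain_Q s
  refine (isHom_of_monotone (h := qqElim (fun x => qConst s (lowToRatConst x))
    (fun _ => qTop s) (qTop s)) ?_ ?_ ?_ ?_ :
      IsHom (QQ p γ) (Q s) _).fails_of_surjective ?_ hε
  · have htop : ∀ z : QCarrier s, z < qTop s ∨ z = qTop s ∧ qTop s = qTop s := fun z => by
      simpa using (hs.le_top z).lt_or_eq
    intro x y
    induction x using QQCarrier.cases <;> induction y using QQCarrier.cases <;> intro hxy
    · rename_i x y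
      by_cases hx : qConst s (lowToRatConst x) = qTop s
      · exact Or.inr ⟨hx, hs.const_eq_top_of_le hx (qqLow_lt_qqLow.1 hxy).le⟩
      · exact Or.inl (hs.const_lt hx (qqLow_lt_qqLow.1 hxy))
    · exact htop _
    · exact htop _
    · exact absurd hxy (not_qqMid_lt_qqLow _ _)
    · exact Or.inr ⟨rfl, rfl⟩
    · exact Or.inr ⟨rfl, rfl⟩
    · exact absurd hxy not_top_lt
    · exact absurd hxy not_top_lt
    · exact absurd hxy not_top_lt
  · rfl
  · exact hs.const_zero
  · intro q
    change qqElim _ _ _ (qqConst p γ q) = qConst s q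
    rcases lt_or_ge p.1 q.1 with hq | hq
    · have : ((p.1 : ℚ) : ℝ) < ((q.1 : ℚ) : ℝ) := by exact_mod_cast hq
      rw [qqConst_of_lt hq, qConst_of_le (hsp.trans this.le)]
      rfl
    · rw [qqConst_of_le hq]
      rfl
  · intro y
    rcases y.2 with h | h
    · have : y.1 ≤ p.1 := by
        have := h.2.le.trans hsp
        exact_mod_cast this
      exact ⟨qqLow p γ ⟨y.1, h.1, this⟩, qConst_toRatConst y⟩
    · exact ⟨(⊤ : QQCarrier p γ), Subtype.ext h.symm⟩

end QQ

/-! ### Local embeddings between rational Gödel chains -/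

section

variable {L : Type u} [LinearOrder L] {bot top : L} {const : RatConst → L}

/-- Cutting off the constants of a rational Gödel chain at a real number, up to finitely many
constants. -/
theorem IsRatChain.exists_cut (h : IsRatChain bot top const) {r : Set.Ioc (0 : ℝ) 1}
    (hr : ∀ q, const q ≠ top → ((q.1 : ℚ) : ℝ) < r.1) {P : Set RatConst} (hP : P.Finite) :
    ∃ s : Set.Ioc (0 : ℝ) 1, s ≤ r ∧ ∀ q ∈ P, const q = top ↔ qConst s q = qTop s := by
  -- The cut is at the least constant of `P` that is already the top, or at `r` if there is none or
  -- it lies beyond `r`.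
  obtain ⟨s, hs, hmin⟩ := Set.exists_min_image
    (insert r.1 ((fun q : RatConst => ((q.1 : ℚ) : ℝ)) '' {q ∈ P | const q = top})) id
    (((hP.subset (Set.sep_subset _ _)).image _).insert _) ⟨_, Or.inl rfl⟩
  have hsr : s ≤ r.1 := hmin _ (Or.inl rfl)
  have hlt : ∀ q, const q ≠ top → ((q.1 : ℚ) : ℝ) < s := by
    intro q hq
    rcases hs with rfl | ⟨q', ⟨_, hq't⟩, rfl⟩
    · exact hr q hq
    · have : q < q' := not_le.1 fun hle => hq (h.const_eq_top_of_le hq't hle)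
      exact Rat.cast_lt.2 this
  refine ⟨⟨s, by simpa using hlt 0 h.const_zero_ne_top, hsr.trans r.2.2⟩, hsr, fun q hq => ?_⟩
  rw [qConst_eq_top_iff]
  refine ⟨fun ht => hmin _ (Or.inr ⟨q, ⟨hq, ht⟩, rfl⟩), fun hle => ?_⟩
  by_contra hcon
  exact absurd (hlt q hcon) (not_lt.2 hle)

/-- An equation failing in a rational Gödel chain whose constants `≠ 1` lie below `r` fails in
`Q r`. -/
theorem IsRatChain.fails_Q (h : IsRatChain bot top const) {r : Set.Ioc (0 : ℝ) 1}
    (hr : ∀ q, const q ≠ top → ((q.1 : ℚ) : ℝ) < r.1) {ε : Equation RatConst}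
    (hε : Fails (chainAlg L bot top const) ε) : Fails (Q r) ε := by
  obtain ⟨e, he⟩ := hε
  have hPfin : (insert 0 ε.consts).Finite := ε.finite_consts.insert _
  -- The constants may reach the top before `r`, so no embedding into `Q r` itself need exist. The
  -- failure is moved to a quotient `Q s` in which the relevant constants behave as in the given
  -- chain.
  obtain ⟨s, hsr, hs⟩ := h.exists_cut hr hPfin
  refine fails_Q_mono hsr ?_
  have h' := isRatChain_Q s
  obtain ⟨f, hft, hfc, hf⟩ := exists_const_map h h' hs
  have hbotmem : bot ∈ insert top (const '' insert 0 ε.consts) :=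
    Or.inr ⟨0, Or.inl rfl, h.const_zero⟩
  obtain ⟨g, hg, hgf⟩ := exists_strictMonoOn_union ((hPfin.image const).insert top)
    (ε.finite_vars.image e) hf (by
      rintro x -
      by_cases hxb : x = bot
      · exact Or.inl (hxb ▸ hbotmem)
      by_cases hxt : x = top
      · exact Or.inl (Or.inl hxt)
      exact Or.inr ⟨bot, hbotmem, top, Or.inl rfl, lt_of_le_of_ne (h.bot_le x) (Ne.symm hxb),
        lt_of_le_of_ne (h.le_top x) hxt, fun y z _ hyz _ => exists_between hyz⟩)
  refine fails_of_strictMonoOn hg (Or.inl hbotmem) (Or.inl (Or.inl rfl)) ?_ ?_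
    (fun c hc => ?_) (fun n hn => Or.inr ⟨n, hn, rfl⟩) he
  · rw [hgf hbotmem, ← h.const_zero, hfc 0 (Or.inl rfl), h'.const_zero]
    rfl
  · exact (hgf (Or.inl rfl)).trans hft
  · have hc' : const c ∈ insert top (const '' insert 0 ε.consts) := Or.inr ⟨c, Or.inr hc, rfl⟩
    exact ⟨Or.inl hc', (hgf hc').trans (hfc c (Or.inr hc))⟩

/-- An equation failing in a rational Gödel chain whose constants `≠ 1` lie below or at `p`, with
at most `γ` elements strictly between `c_p` and `1`, fails in `QQ p γ`. -/
theorem IsRatChain.fails_QQ (h : IsRatChain bot top const) {p : Set.Ico (0 : ℚ) 1} {γ : ℕ∞}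
    (hp : ∀ q, const q ≠ top → q.1 ≤ p.1)
    (hγ : ∀ U : Finset L, ↑U ⊆ Set.Ioo (const (toRatConst p)) top → (U.card : ℕ∞) ≤ γ)
    {ε : Equation RatConst} (hε : Fails (chainAlg L bot top const) ε) : Fails (QQ p γ) ε := by
  classical
  -- If `c_p` is already the top, the other constants different from the top lie strictly below `p`.
  -- The chain then compares with `Q p`, a quotient of `QQ p γ`; here `p > 0` because `c_0` is not
  -- the top.
  by_cases hpt : const (toRatConst p) = top
  · have hlt : ∀ q, const q ≠ top → q.1 < p.1 := fun q hq =>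
      lt_of_not_ge fun hle => hq (h.const_eq_top_of_le hpt (q := q) hle)
    have hp0 : 0 < p.1 := hlt 0 h.const_zero_ne_top
    refine fails_QQ_of_fails_Q (s := ⟨p.1, by exact_mod_cast hp0, by exact_mod_cast p.2.2.le⟩)
      le_rfl (h.fails_Q (fun q hq => ?_) hε)
    exact Rat.cast_lt.2 (hlt q hq)
  obtain ⟨e, he⟩ := hε
  change ℕ → L at e
  have h' := isRatChain_QQ p γ
  set c := const (toRatConst p) with hc
  have hct : c < top := lt_of_le_of_ne (h.le_top _) hpt
  let P : Set RatConst := insert 0 (insert (toRatConst p) ε.consts)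
  have hPfin : P.Finite := (ε.finite_consts.insert _).insert _
  have hconst : ∀ q, const q = top ↔ qqConst p γ q = ⊤ := by
    intro q
    rw [qqConst_eq_top_iff]
    constructor
    · intro hq
      by_contra hcon
      exact hpt (h.const_eq_top_of_le hq (q := toRatConst p) (not_lt.1 hcon))
    · intro hq
      by_contra hcon
      exact absurd (hp q hcon) (not_le.2 hq)
  obtain ⟨f, hft, hfc, hf⟩ := exists_const_map h h' (P := P) fun q _ => hconst q
  have hcle : ∀ q, const q = top ∨ const q ≤ c := fun q => by
    by_cases hq : const q = top
    · exact Or.inl hq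
    · exact Or.inr (h.const_mono (q := toRatConst p) (hp q hq))
  have hUfin : (e '' ε.vars ∩ Set.Ioo c top).Finite :=
    (ε.finite_vars.image e).subset Set.inter_subset_left
  let U : Finset L := hUfin.toFinset
  have hU : ∀ x, x ∈ U ↔ x ∈ e '' ε.vars ∧ x ∈ Set.Ioo c top := fun x => by simp [U]
  -- A value strictly between `c_p` and the top is sent to `t_k`, where `k` is its rank among such
  -- values. The height bound guarantees that `t_k` exists.
  have hrank : ∀ x ∈ U, (((U.filter (· < x)).card : ℕ) : ℕ∞) < γ := by
    intro x hx
    have h1 : (U.filter (· < x)).card < U.card :=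
      Finset.card_lt_card (Finset.filter_ssubset.2 ⟨x, hx, lt_irrefl x⟩)
    refine lt_of_lt_of_le (Nat.cast_lt.2 h1) (hγ U fun y hy => ((hU y).1 hy).2)
  let f' : L → QQCarrier p γ := fun x =>
    if hx : x ∈ U then qqMid p γ ⟨_, hrank x hx⟩ else f x
  have hf'U : ∀ x (hx : x ∈ U), f' x = qqMid p γ ⟨_, hrank x hx⟩ := fun x hx => dif_pos hx
  have hf'n : ∀ x, x ∉ U → f' x = f x := fun x hx => dif_neg hx
  have hnU : ∀ x ∈ insert top (const '' P), x ∉ U := by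
    rintro x (rfl | ⟨q, -, rfl⟩) hx
    · exact lt_irrefl _ ((hU _).1 hx).2.2
    · rcases hcle q with hq | hq
      · exact ((hU _).1 hx).2.2.ne hq
      · exact absurd ((hU _).1 hx).2.1 (not_lt.2 hq)
  have hfP : ∀ q ∈ P, f' (const q) = qqConst p γ q := fun q hq =>
    (hf'n _ (hnU _ (Or.inr ⟨q, hq, rfl⟩))).trans (hfc q hq)
  have hf't : f' top = ⊤ := (hf'n _ (hnU _ (Or.inl rfl))).trans hft
  have hf' : StrictMonoOn f' (insert top (const '' P) ∪ U) := by
    have hlow : ∀ q ∈ P, const q ≠ top → ∀ n, f' (const q) < qqMid p γ n := by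
      intro q hq hqt n
      rw [hfP q hq, qqConst_of_le (hp q hqt)]
      exact qqLow_lt_qqMid _ _
    rintro x (hx | hx) y (hy | hy) hxy
    · rw [hf'n _ (hnU _ hx), hf'n _ (hnU _ hy)]
      exact hf hx hy hxy
    · rw [hf'U y hy]
      rcases hx with rfl | ⟨q, hq, rfl⟩
      · exact absurd (h.le_top y) (not_le.2 hxy)
      · exact hlow q hq (hxy.trans_le (h.le_top _)).ne _
    · have hx' := ((hU x).1 hx).2
      rw [hf'U x hx]
      rcases hy with rfl | ⟨q, hq, rfl⟩
      · rw [hf't]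
        exact qqMid_lt_top _
      · rcases hcle q with hqt | hqc
        · rw [hqt, hf't]
          exact qqMid_lt_top _
        · exact absurd (hx'.1.trans hxy) (not_lt.2 hqc)
    · rw [hf'U x hx, hf'U y hy, qqMid_lt_qqMid]
      refine Subtype.coe_lt_coe.1 (Finset.card_lt_card ?_)
      refine Finset.ssubset_iff_subset_ne.2 ⟨fun z hz => ?_, fun heq => ?_⟩
      · rw [Finset.mem_filter] at hz ⊢
        exact ⟨hz.1, hz.2.trans hxy⟩
      · have : x ∈ U.filter (· < x) := heq ▸ Finset.mem_filter.2 ⟨hx, hxy⟩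
        exact lt_irrefl _ (Finset.mem_filter.1 this).2
  have hbotmem : bot ∈ insert top (const '' P) ∪ (U : Set L) :=
    Or.inl (Or.inr ⟨0, Or.inl rfl, h.const_zero⟩)
  have hpP : toRatConst p ∈ P := Or.inr (Or.inl rfl)
  have hcmem : c ∈ insert top (const '' P) ∪ (U : Set L) := Or.inl (Or.inr ⟨_, hpP, rfl⟩)
  have hfc' : f' c = qqLow p γ ⟨p.1, p.2.1, le_rfl⟩ :=
    (hfP _ hpP).trans (qqConst_of_le (q := toRatConst p) le_rfl)
  obtain ⟨g, hg, hgf⟩ := exists_strictMonoOn_union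
    (((hPfin.image const).insert top).union U.finite_toSet) (ε.finite_vars.image e) hf' (by
      rintro x hx
      by_cases hxb : x = bot
      · exact Or.inl (hxb ▸ hbotmem)
      by_cases hxt : x = top
      · exact Or.inl (Or.inl (Or.inl hxt))
      have hxlt := lt_of_le_of_ne (h.le_top x) hxt
      rcases lt_trichotomy x c with hxc | hxc | hxc
      -- Only values below `c_p` remain to be placed, and the target segment is the dense order `[0,
      -- p] ∩ ℚ`.
      · refine Or.inr ⟨bot, hbotmem, c, hcmem, lt_of_le_of_ne (h.bot_le x) (Ne.symm hxb), hxc, ?_⟩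
        intro y z _ hyz hzc
        rw [hfc'] at hzc
        induction z using QQCarrier.cases with
        | hlow b =>
          induction y using QQCarrier.cases with
          | hlow a =>
            obtain ⟨w, hw1, hw2⟩ := exists_between (qqLow_lt_qqLow.1 hyz)
            exact ⟨qqLow p γ w, qqLow_lt_qqLow.2 hw1, qqLow_lt_qqLow.2 hw2⟩
          | hmid n => exact absurd hyz (not_qqMid_lt_qqLow _ _)
          | htop => exact absurd hyz not_top_lt
        | hmid n => exact absurd (qqLow_lt_qqMid _ _) (not_lt.2 hzc)
        | htop => exact absurd (qqLow_lt_top _) (not_lt.2 hzc)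
      · exact Or.inl (hxc ▸ hcmem)
      · exact Or.inl (Or.inr ((hU x).2 ⟨hx, hxc, hxlt⟩)))
  refine fails_of_strictMonoOn hg (Or.inl hbotmem) (Or.inl (Or.inl (Or.inl rfl))) ?_ ?_
    (fun q hq => ?_) (fun n hn => Or.inr ⟨n, hn, rfl⟩) he
  · rw [hgf hbotmem, ← h.const_zero, hfP 0 (Or.inl rfl), h'.const_zero]
    rfl
  · exact (hgf (Or.inl (Or.inl rfl))).trans hf't
  · have hq' : q ∈ P := Or.inr (Or.inr hq)
    have hmem : const q ∈ insert top (const '' P) ∪ (U : Set L) := Or.inl (Or.inr ⟨q, hq', rfl⟩)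
    exact ⟨Or.inl hmem, (hgf hmem).trans (hfP q hq')⟩

end

/-- An equation failing in `Q r` fails in every rational Gödel chain in which a sufficiently large
constant below `r` differs from `1`, and the constants from `r` on are `1`. -/
theorem exists_const_of_fails_Q {r : Set.Ioc (0 : ℝ) 1} {ε : Equation RatConst}
    (hε : Fails (Q r) ε) : ∃ q₀ : RatConst, ((q₀.1 : ℚ) : ℝ) < r.1 ∧
      ∀ {L : Type u} [LinearOrder L] {bot top : L} {const : RatConst → L},
        IsRatChain bot top const → const q₀ ≠ top →
        (∀ q : RatConst, r.1 ≤ ((q.1 : ℚ) : ℝ) → const q = top) →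
        Fails (chainAlg L bot top const) ε := by
  obtain ⟨e, he⟩ := hε
  change ℕ → QCarrier r at e
  -- Every element of `Q r` is named by a constant. Here `q₀` is the largest index below `r` among
  -- 0, the constants of the equation and the names of the values of its variables.
  obtain ⟨q₀, ⟨-, hq₀⟩, hmax⟩ := Set.exists_max_image
    ((insert 0 (ε.consts ∪ (fun n => (e n).toRatConst) '' ε.vars)) ∩
      {q : RatConst | ((q.1 : ℚ) : ℝ) < r.1}) id
    (((ε.finite_consts.union (ε.finite_vars.image _)).insert _).subset Set.inter_subset_left)
    ⟨0, Or.inl rfl, by simpa using r.2.1⟩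
  refine ⟨q₀, hq₀, fun {L} _ {bot top const} h hq₀t hr => ?_⟩
  have hS : StrictMonoOn (fun x : QCarrier r => const x.toRatConst)
      {x | x.toRatConst ≤ q₀ ∨ x = qTop r} := by
    rintro x (hx | rfl) y - hxy
    · exact h.const_lt (h.const_ne_top_of_le hq₀t hx) hxy
    · exact absurd (le_qTop y) (not_le.2 hxy)
  refine fails_of_strictMonoOn (bot := qBot r) (top := qTop r) (const := qConst r) hS (Or.inl (ratConst_zero_le _)) (Or.inr rfl)
    h.const_zero h.const_one ?_ ?_ he
  · intro q hq
    rcases lt_or_ge ((q.1 : ℚ) : ℝ) r.1 with hqr | hqr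
    · rw [qConst_of_lt hqr]
      exact ⟨Or.inl (hmax q ⟨Or.inr (Or.inl hq), hqr⟩), rfl⟩
    · rw [qConst_of_le hqr, hr q hqr]
      exact ⟨Or.inr rfl, h.const_one⟩
  · intro n hn
    rcases lt_or_ge ((e n).1 : ℝ) r.1 with hnr | hnr
    · exact Or.inl (hmax _ ⟨Or.inr (Or.inr ⟨n, hn, rfl⟩), hnr⟩)
    · exact Or.inr (qTop_of_le hnr)

/-- An equation failing in `QQ p γ` fails in every rational Gödel chain with sufficiently many
elements strictly between `c_p` and `1` in which the constants above `p` are `1`. -/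
theorem exists_card_of_fails_QQ {p : Set.Ico (0 : ℚ) 1} {γ : ℕ∞} {ε : Equation RatConst}
    (hε : Fails (QQ p γ) ε) : ∃ m : ℕ, (m : ℕ∞) ≤ γ ∧
      ∀ {L : Type u} [LinearOrder L] {bot top : L} {const : RatConst → L},
        IsRatChain bot top const → const (toRatConst p) ≠ top →
        (∀ q : RatConst, p.1 < q.1 → const q = top) →
        ∀ U : Finset L, ↑U ⊆ Set.Ioo (const (toRatConst p)) top → U.card = m →
        Fails (chainAlg L bot top const) ε := by
  obtain ⟨e, he⟩ := hε
  change ℕ → QQCarrier p γ at e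
  -- A finite `γ` serves as `m` itself; for `γ = ω` finitely many variables use only finitely many
  -- of the `t_k`.
  obtain ⟨m, hmγ, hm⟩ : ∃ m : ℕ, (m : ℕ∞) ≤ γ ∧
      ∀ n ∈ ε.vars, ∀ k, e n = qqMid p γ k → k.1 < m := by
    induction γ using ENat.recTopCoe with
    | top =>
      obtain ⟨b, hb⟩ := (ε.finite_vars.image fun n =>
        qqElim (fun _ => 0) (fun k => k.1) 0 (e n)).bddAbove
      refine ⟨b + 1, le_top, fun n hn k hk => ?_⟩
      have := hb ⟨n, hn, rfl⟩
      simp only [hk, qqElim_mid] at this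
      omega
    | coe m => exact ⟨m, le_rfl, fun n _ k _ => by exact_mod_cast k.2⟩
  refine ⟨m, hmγ, fun {L} _ {bot top const} h hpt hr U hU hUm => ?_⟩
  let g : QQCarrier p γ → L := qqElim (fun x => const (lowToRatConst x))
    -- The `t_k` with `k ≥ m` do not occur in the evaluation, so their default image is irrelevant.
    (fun k => if hk : k.1 < m then U.orderEmbOfFin hUm ⟨k.1, hk⟩ else top) top
  have hmid : ∀ k (hk : k.1 < m), g (qqMid p γ k) = U.orderEmbOfFin hUm ⟨k.1, hk⟩ :=
    fun k hk => dif_pos hk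
  have hmem : ∀ i, U.orderEmbOfFin hUm i ∈ Set.Ioo (const (toRatConst p)) top :=
    fun i => hU (U.orderEmbOfFin_mem hUm i)
  have hxp : ∀ x : Set.Icc (0 : ℚ) p.1, lowToRatConst x ≤ toRatConst p := fun x => x.2.2
  have hS : StrictMonoOn g {x | ∀ k, x = qqMid p γ k → k.1 < m} := by
    intro x hx y hy
    induction x using QQCarrier.cases <;> induction y using QQCarrier.cases <;> intro hxy
    · exact h.const_lt (h.const_ne_top_of_le hpt (hxp _)) (qqLow_lt_qqLow.1 hxy)
    · rw [hmid _ (hy _ rfl)]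
      exact (h.const_mono (hxp _)).trans_lt (hmem _).1
    · exact lt_of_le_of_ne (h.le_top _) (h.const_ne_top_of_le hpt (hxp _))
    · exact absurd hxy (not_qqMid_lt_qqLow _ _)
    · rw [hmid _ (hx _ rfl), hmid _ (hy _ rfl), OrderEmbedding.lt_iff_lt]
      exact qqMid_lt_qqMid.1 hxy
    · rw [hmid _ (hx _ rfl)]
      exact (hmem _).2
    · exact absurd hxy not_top_lt
    · exact absurd hxy not_top_lt
    · exact absurd hxy not_top_lt
  refine fails_of_strictMonoOn (bot := qqBot p γ) (top := ⊤) (const := qqConst p γ) hS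
    (fun k hk => absurd hk (qqLow_lt_qqMid _ _).ne)
    (fun k hk => absurd hk.symm (qqMid_lt_top _).ne) h.const_zero rfl ?_ hm he
  intro q _
  rcases lt_or_ge p.1 q.1 with hq | hq
  · rw [qqConst_of_lt hq, hr q hq]
    exact ⟨fun k hk => absurd hk.symm (qqMid_lt_top _).ne, rfl⟩
  · rw [qqConst_of_le hq]
    exact ⟨fun k hk => absurd hk (qqLow_lt_qqMid _ _).ne, rfl⟩

/-! ### Rational Gödel algebras as an equational class -/

/-- The inclusion of the formulas without constants. -/
def Fm.embed : Fm Empty → Fm RatConst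
  | .var n => .var n
  | .const c => c.elim
  | .zero => .zero
  | .one => .one
  | .meet s t => .meet s.embed t.embed
  | .join s t => .join s.embed t.embed
  | .mul s t => .mul s.embed t.embed
  | .imp s t => .imp s.embed t.embed

theorem Fm.eval_embed {A : Alg.{u} RatConst} (e : ℕ → A.carrier) (φ : Fm Empty) :
    φ.embed.eval A e = φ.eval A.reduct e := by
  induction φ with
  | var n => rfl
  | const c => exact c.elim
  | zero => rfl
  | one => rfl
  | meet s t hs ht => exact congrArg₂ A.meet hs ht
  | join s t hs ht => exact congrArg₂ A.join hs ht
  | mul s t hs ht => exact congrArg₂ A.mul hs ht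
  | imp s t hs ht => exact congrArg₂ A.imp hs ht

/-- An equational axiomatization of the class of rational Gödel algebras. -/
def rgaAxioms : Set (Equation RatConst) :=
  {ε | (∃ δ : Equation Empty, ¬ Fails stdG δ ∧ ε = ⟨δ.lhs.embed, δ.rhs.embed⟩) ∨
    (∃ p q : RatConst, ε = ⟨.mul (.const p) (.const q), .const (min p q)⟩) ∨
    (∃ p q : RatConst, ε = ⟨.imp (.const p) (.const q), .const (godelImp 1 p q)⟩) ∨
    ε = ⟨.const 0, .zero⟩ ∨ ε = ⟨.const 1, .one⟩}

theorem mem_RGA_iff {A : Alg.{u} RatConst} : A ∈ RGA ↔ A.Models rgaAxioms := by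
  constructor
  · rintro ⟨hG, hmin, himp, h0, h1⟩ ε hε e
    rcases hε with ⟨δ, hδ, rfl⟩ | ⟨p, q, rfl⟩ | ⟨p, q, rfl⟩ | rfl | rfl
    · change δ.lhs.embed.eval A e = δ.rhs.embed.eval A e
      rw [Fm.eval_embed, Fm.eval_embed]
      by_contra hne
      exact hδ (mem_V_singleton.1 hG δ ⟨e, hne⟩)
    · exact hmin p q
    · exact himp p q
    · exact h0
    · exact h1
  · intro h
    refine ⟨mem_V_singleton.2 ?_, fun p q => ?_, fun p q => ?_, ?_, ?_⟩
    · rintro δ ⟨e, he⟩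
      by_contra hδ
      apply he
      have := h _ (Or.inl ⟨δ, hδ, rfl⟩) e
      exact (Fm.eval_embed (A := A) e δ.lhs).symm.trans
        (this.trans (Fm.eval_embed (A := A) e δ.rhs))
    · exact h _ (Or.inr (Or.inl ⟨p, q, rfl⟩)) fun _ => A.zero
    · exact h _ (Or.inr (Or.inr (Or.inl ⟨p, q, rfl⟩))) fun _ => A.zero
    · exact h _ (Or.inr (Or.inr (Or.inr (Or.inl rfl)))) fun _ => A.zero
    · exact h _ (Or.inr (Or.inr (Or.inr (Or.inr rfl)))) fun _ => A.zero

theorem isVariety_RGA : IsVariety (RGA : Set (Alg.{u} RatConst)) :=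
  ⟨rgaAxioms, Set.ext fun _ => mem_RGA_iff⟩

theorem V_subset_RGA {B : Alg.{v} RatConst} (hB : B ∈ RGA) :
    (V {B} : Set (Alg.{u} RatConst)) ⊆ RGA := by
  intro A hA
  refine mem_RGA_iff.2 (hA _ ?_)
  rintro _ rfl
  exact mem_RGA_iff.1 hB

theorem Q_mem_RGA (r : Set.Ioc (0 : ℝ) 1) : Q r ∈ RGA := (isRatChain_Q r).mem_RGA

theorem QQ_mem_RGA (p : Set.Ico (0 : ℚ) 1) (γ : ℕ∞) : QQ p γ ∈ RGA := (isRatChain_QQ p γ).mem_RGA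

/-- The equation `φ ≈ 1`. -/
def Fm.eqOne (φ : Fm RatConst) : Equation RatConst := ⟨φ, .one⟩

theorem models_eqOne_iff {A : Alg.{u} RatConst} {Γ : Set (Fm RatConst)} :
    A.Models (eqOne Γ) ↔ ∀ φ ∈ Γ, ¬ Fails A φ.eqOne := by
  rw [models_iff_not_fails]
  constructor
  · exact fun h φ hφ => h _ ⟨φ, hφ, rfl⟩
  · rintro h _ ⟨φ, hφ, rfl⟩
    exact h φ hφ

theorem fails_const_iff {A : Alg.{u} RatConst} {q : RatConst} :
    Fails A (Fm.const q).eqOne ↔ A.const q ≠ A.one :=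
  ⟨fun ⟨_, he⟩ => he, fun h => ⟨fun _ => A.one, h⟩⟩

/-- An equation failing in a member of an equational class of rational Gödel algebras fails in a
chain of that class. -/
theorem exists_ratChain_of_fails {K : Set (Alg.{u} RatConst)} (hK : IsVariety K) (hR : K ⊆ RGA)
    {A : Alg.{u} RatConst} (hA : A ∈ K) {ε : Equation RatConst} (hε : Fails A ε) :
    ∃ (L : Type u) (_ : LinearOrder L) (bot top : L) (const : RatConst → L),
      IsRatChain bot top const ∧ chainAlg L bot top const ∈ K ∧
        Fails (chainAlg L bot top const) ε := by
  obtain ⟨E, rfl⟩ := hK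
  obtain ⟨e, he⟩ := hε
  obtain ⟨L, hL, bot, top, const, hch, h, hs, hh, hne⟩ := exists_ratChain_quotient (hR hA) he
  refine ⟨L, hL, bot, top, const, hch, hh.models_of_surjective hs hA, fun n => h (e n), ?_⟩
  rwa [← hh.eval, ← hh.eval]

/-! ### Axiomatizations -/

theorem isVariety_models {K : Set (Alg.{u} RatConst)} (hK : IsVariety K)
    (E : Set (Equation RatConst)) : IsVariety {A | A ∈ K ∧ A.Models E} := by
  obtain ⟨F, rfl⟩ := hK
  refine ⟨F ∪ E, Set.ext fun A => ?_⟩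
  exact ⟨fun h ε hε => hε.elim (h.1 ε) (h.2 ε),
    fun h => ⟨fun ε hε => h ε (Or.inl hε), fun ε hε => h ε (Or.inr hε)⟩⟩

/-- For the harder inclusion, a failing equation is moved to a chain that still satisfies the
axioms. These axioms are exactly the hypothesis of `IsRatChain.fails_Q`. -/
theorem V_Q_eq (r : Set.Ioc (0 : ℝ) 1) :
    (V {Q r} : Set (Alg.{u} RatConst)) = {A | A ∈ RGA ∧ A.Models (eqOne (axQ r))} := by
  refine Set.Subset.antisymm (fun A hA => ⟨V_subset_RGA (Q_mem_RGA r) hA, ?_⟩) ?_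
  · refine hA _ ?_
    rintro _ rfl
    refine models_eqOne_iff.2 ?_
    rintro _ ⟨q, hq, rfl⟩ hf
    exact fails_const_iff.1 hf (qConst_of_le hq)
  · intro A hA
    refine mem_V_singleton.2 fun ε hε => ?_
    obtain ⟨L, hL, bot, top, const, hch, hmem, hf⟩ :=
      exists_ratChain_of_fails (isVariety_models isVariety_RGA _) (fun _ h => h.1) hA hε
    refine hch.fails_Q (fun q hq => ?_) hf
    by_contra hcon
    exact models_eqOne_iff.1 hmem.2 _ ⟨q, not_lt.1 hcon, rfl⟩ (fails_const_iff.2 hq)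

theorem card_le_of_subset_Ioo_QQ {p : Set.Ico (0 : ℚ) 1} {γ : ℕ∞} (U : Finset (QQCarrier p γ))
    (hU : ↑U ⊆ Set.Ioo (qqConst p γ (toRatConst p)) ⊤) : (U.card : ℕ∞) ≤ γ := by
  induction γ using ENat.recTopCoe with
  | top => exact le_top
  | coe n =>
    refine Nat.cast_le.2 ?_
    have hmid : ∀ x ∈ U, ∃ k, x = qqMid p n k := by
      intro x hx
      have hx' := hU hx
      induction x using QQCarrier.cases with
      | hlow a =>
        have h1 : qqConst p n (toRatConst p) < qqLow p n a := hx'.1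
        rw [qqConst_of_le (q := toRatConst p) le_rfl, qqLow_lt_qqLow] at h1
        exact absurd a.2.2 (not_le.2 h1)
      | hmid k => exact ⟨k, rfl⟩
      | htop => exact absurd hx'.2 (lt_irrefl _)
    have := Finset.card_le_card_of_injOn (s := U) (t := Finset.range n)
      (qqElim (fun _ => 0) (fun k => k.1) 0) ?_ ?_
    · rwa [Finset.card_range] at this
    · intro x hx
      obtain ⟨k, rfl⟩ := hmid x hx
      simpa using k.2
    · intro x hx y hy hxy
      obtain ⟨k, rfl⟩ := hmid x hx
      obtain ⟨l, rfl⟩ := hmid y hy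
      exact congrArg _ (Subtype.ext hxy)

theorem not_fails_axHeight_QQ_iff {p : Set.Ico (0 : ℚ) 1} {γ : ℕ∞} {n : ℕ} :
    ¬ Fails (QQ p γ) (axHeight p n).eqOne ↔ γ ≤ n := by
  classical
  refine (models_axHeight_iff (isRatChain_QQ p γ) p n).trans ⟨fun h => ?_, fun h U hU => ?_⟩
  · by_contra! hcon
    have hlt : ∀ i : Fin (n + 1), ((i.1 : ℕ) : ℕ∞) < γ := fun i =>
      lt_of_le_of_lt (Nat.cast_le.2 (Nat.lt_succ_iff.1 i.2)) hcon
    have hinj : Function.Injective fun i : Fin (n + 1) => qqMid p γ ⟨i.1, hlt i⟩ := by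
      intro i j hij
      have h2 := congrArg (qqElim (fun _ => 0) (fun k => k.1) 0) hij
      exact Fin.ext h2
    have := h (Finset.univ.map ⟨_, hinj⟩) (by
      intro x hx
      simp only [Finset.coe_map, Set.mem_image, Function.Embedding.coeFn_mk] at hx
      obtain ⟨i, -, rfl⟩ := hx
      rw [qqConst_of_le (q := toRatConst p) le_rfl]
      exact ⟨qqLow_lt_qqMid _ _, qqMid_lt_top _⟩)
    simp at this
  · exact_mod_cast (card_le_of_subset_Ioo_QQ U hU).trans h

/-- The set-builder adds the height axiom when `γ` is finite and nothing when `γ = ω`, so both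
axiomatizations come from one argument based on `IsRatChain.fails_QQ`. -/
theorem V_QQ_eq (p : Set.Ico (0 : ℚ) 1) (γ : ℕ∞) :
    (V {QQ p γ} : Set (Alg.{u} RatConst)) =
      {A | A ∈ RGA ∧ A.Models (eqOne (axQQ p ∪ {φ | ∃ n : ℕ, γ = n ∧ φ = axHeight p n}))} := by
  refine Set.Subset.antisymm (fun A hA => ⟨V_subset_RGA (QQ_mem_RGA p γ) hA, ?_⟩) ?_
  · refine hA _ ?_
    rintro _ rfl
    refine models_eqOne_iff.2 ?_
    rintro _ (⟨q, hq, rfl⟩ | ⟨n, hn, rfl⟩)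
    · exact fun hf => fails_const_iff.1 hf (qqConst_of_lt hq)
    · exact not_fails_axHeight_QQ_iff.2 hn.le
  · intro A hA
    refine mem_V_singleton.2 fun ε hε => ?_
    obtain ⟨L, hL, bot, top, const, hch, hmem, hf⟩ :=
      exists_ratChain_of_fails (isVariety_models isVariety_RGA _) (fun _ h => h.1) hA hε
    have hax := models_eqOne_iff.1 hmem.2
    refine hch.fails_QQ (fun q hq => ?_) (fun U hU => ?_) hf
    · by_contra hcon
      exact hax _ (Or.inl ⟨q, not_le.1 hcon, rfl⟩) (fails_const_iff.2 hq)
    · induction γ using ENat.recTopCoe with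
      | top => exact le_top
      | coe n =>
        exact Nat.cast_le.2
          ((models_axHeight_iff hch p n).1 (hax _ (Or.inr ⟨n, rfl, rfl⟩)) U hU)

theorem V_QQ_coe_eq (p : Set.Ico (0 : ℚ) 1) (n : ℕ) :
    (V {QQ p (n : ℕ∞)} : Set (Alg.{u} RatConst)) =
      {A | A ∈ RGA ∧ A.Models (eqOne (axQQ p ∪ {axHeight p n}))} := by
  have : {φ | ∃ m : ℕ, (n : ℕ∞) = m ∧ φ = axHeight p m} = {axHeight p n} := by
    ext φ
    simp
  rw [V_QQ_eq, this]

theorem V_QQ_top_eq (p : Set.Ico (0 : ℚ) 1) :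
    (V {QQ p ⊤} : Set (Alg.{u} RatConst)) = {A | A ∈ RGA ∧ A.Models (eqOne (axQQ p))} := by
  have : {φ | ∃ m : ℕ, (⊤ : ℕ∞) = m ∧ φ = axHeight p m} = ∅ := by
    ext φ
    simp
  rw [V_QQ_eq, this, Set.union_empty]

/-! ### The inclusion order -/

/-- If `r₂ < r₁`, a rational strictly between them names a constant that is 1 in `Q r₂` but not in
`Q r₁`. -/
theorem V_Q_subset_V_Q {r₁ r₂ : Set.Ioc (0 : ℝ) 1} :
    (V {Q r₁} : Set (Alg.{u} RatConst)) ⊆ V {Q r₂} ↔ r₁ ≤ r₂ := by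
  refine V_subset_V.trans ⟨fun h => ?_, fun h ε => fails_Q_mono h⟩
  by_contra! hcon
  obtain ⟨q, hq2, hq1⟩ := exists_rat_btwn (show r₂.1 < r₁.1 from hcon)
  have h0 : (0 : ℝ) < q := r₂.2.1.trans hq2
  have h1 : (q : ℝ) ≤ 1 := hq1.le.trans r₁.2.2
  let q' : RatConst := ⟨q, by exact_mod_cast h0.le, by exact_mod_cast h1⟩
  exact fails_const_iff.1 (h (Fm.const q').eqOne (fails_const_iff.2 fun ht =>
    absurd (qConst_eq_top_iff.1 ht) (not_le.2 hq1))) (qConst_of_le (q := q') hq2.le)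

theorem V_Q_subset_V_QQ {r : Set.Ioc (0 : ℝ) 1} {p : Set.Ico (0 : ℚ) 1} {γ : ℕ∞} :
    (V {Q r} : Set (Alg.{u} RatConst)) ⊆ V {QQ p γ} ↔ (r : ℝ) ≤ ((p : ℚ) : ℝ) := by
  refine V_subset_V.trans ⟨fun h => ?_, fun h ε => fails_QQ_of_fails_Q h⟩
  by_contra! hcon
  obtain ⟨q, hq2, hq1⟩ := exists_rat_btwn hcon
  have hpq : p.1 < q := by exact_mod_cast hq2
  have h1 : (q : ℝ) ≤ 1 := hq1.le.trans r.2.2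
  let q' : RatConst := ⟨q, p.2.1.trans hpq.le, by exact_mod_cast h1⟩
  exact fails_const_iff.1 (h (Fm.const q').eqOne (fails_const_iff.2 fun ht =>
    absurd (qConst_eq_top_iff.1 ht) (not_le.2 hq1))) (qqConst_of_lt (q := q') hpq)

theorem V_QQ_subset_V_Q {r : Set.Ioc (0 : ℝ) 1} {p : Set.Ico (0 : ℚ) 1} {γ : ℕ∞} :
    (V {QQ p γ} : Set (Alg.{u} RatConst)) ⊆ V {Q r} ↔ ((p : ℚ) : ℝ) < (r : ℝ) := by
  refine V_subset_V.trans ⟨fun h => ?_, fun h ε => (isRatChain_QQ p γ).fails_Q fun q hq => ?_⟩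
  · by_contra! hcon
    exact fails_const_iff.1 (h (Fm.const (toRatConst p)).eqOne (fails_const_iff.2 fun ht =>
      lt_irrefl _ (qqConst_eq_top_iff.1 ht))) (qConst_of_le (q := toRatConst p) hcon)
  · have hqp : q.1 ≤ p.1 := not_lt.1 fun hlt => hq (qqConst_of_lt hlt)
    exact lt_of_le_of_lt (Rat.cast_le.2 hqp) h

/-- The constant of `p₁` separates when `p₂ < p₁`, and a height axiom separates when the rationals
agree. If `p₁ < p₂`, the constant of `p₂` is the top in `QQ p₁ γ₁`, so the height bound for `p₂` is
vacuous. -/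
theorem V_QQ_subset_V_QQ {p₁ p₂ : Set.Ico (0 : ℚ) 1} {γ₁ γ₂ : ℕ∞} :
    (V {QQ p₁ γ₁} : Set (Alg.{u} RatConst)) ⊆ V {QQ p₂ γ₂} ↔
      p₁ < p₂ ∨ (p₁ = p₂ ∧ γ₁ ≤ γ₂) := by
  refine V_subset_V.trans ⟨fun h => ?_, fun h ε => (isRatChain_QQ p₁ γ₁).fails_QQ
    (fun q hq => ?_) fun U hU => ?_⟩
  · have hle : p₁ ≤ p₂ := by
      by_contra! hcon
      exact fails_const_iff.1 (h (Fm.const (toRatConst p₁)).eqOne (fails_const_iff.2 fun ht =>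
        lt_irrefl _ (qqConst_eq_top_iff.1 ht))) (qqConst_of_lt (q := toRatConst p₁) hcon)
    refine hle.lt_or_eq.imp_right ?_
    rintro rfl
    refine ⟨rfl, ?_⟩
    by_contra! hcon
    lift γ₂ to ℕ using hcon.ne_top
    have h1 : ¬ Fails (QQ p₁ γ₂) (axHeight p₁ γ₂).eqOne := not_fails_axHeight_QQ_iff.2 le_rfl
    exact absurd (not_fails_axHeight_QQ_iff.1 fun hf => h1 (h _ hf)) (not_le.2 hcon)
  · have hqp : q.1 ≤ p₁.1 := not_lt.1 fun hlt => hq (qqConst_of_lt hlt)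
    rcases h with h | ⟨rfl, -⟩
    · exact hqp.trans (le_of_lt h)
    · exact hqp
  · rcases h with h | ⟨rfl, h⟩
    · rw [qqConst_of_lt (q := toRatConst p₂) h, Set.Ioo_self, Set.subset_empty_iff,
        Finset.coe_eq_empty] at hU
      simp [hU]
    · exact (card_le_of_subset_Ioo_QQ U hU).trans h

/-! ### The classification of the nontrivial varieties -/

theorem exists_ratChain_of_isNontrivialClass {K : Set (Alg.{u} RatConst)} (hK : IsVariety K)
    (hR : K ⊆ RGA) (hN : IsNontrivialClass K) : ∃ (L : Type u) (_ : LinearOrder L) (bot top : L)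
      (const : RatConst → L), IsRatChain bot top const ∧ chainAlg L bot top const ∈ K := by
  obtain ⟨A, hA, x, y, hxy⟩ := hN
  obtain ⟨L, hL, bot, top, const, hch, hmem, -⟩ := exists_ratChain_of_fails hK hR hA
    (ε := ⟨.var 0, .var 1⟩) ⟨assign x y y, hxy⟩
  exact ⟨L, hL, bot, top, const, hch, hmem⟩

theorem eq_V_Q_or_eq_V_QQ {K : Set (Alg.{u} RatConst)} (hK : IsVariety K) (hR : K ⊆ RGA)
    (hN : IsNontrivialClass K) : (∃ r : Set.Ioc (0 : ℝ) 1, K = V {Q r}) ∨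
      ∃ (p : Set.Ico (0 : ℚ) 1) (γ : ℕ∞), K = V {QQ p γ} := by
  classical
  -- This down-set of `[0, 1)` contains 0. Whether it has a maximum decides between the two
  -- families.
  let I : Set RatConst := {q | ∃ A ∈ K, Fails A (Fm.const q).eqOne}
  have hI : ∀ q ∈ I, ∃ (L : Type u) (_ : LinearOrder L) (bot top : L) (const : RatConst → L),
      IsRatChain bot top const ∧ chainAlg L bot top const ∈ K ∧ const q ≠ top := by
    rintro q ⟨A, hA, hf⟩
    obtain ⟨L, hL, bot, top, const, hch, hmem, hf⟩ := exists_ratChain_of_fails hK hR hA hf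
    exact ⟨L, hL, bot, top, const, hch, hmem, fails_const_iff.1 hf⟩
  have hI' : ∀ {L : Type u} [LinearOrder L] {bot top : L} {const : RatConst → L},
      chainAlg L bot top const ∈ K → ∀ q, const q ≠ top → q ∈ I :=
    fun hmem q hq => ⟨_, hmem, fails_const_iff.2 hq⟩
  have h0 : 0 ∈ I := by
    obtain ⟨L, hL, bot, top, const, hch, hmem⟩ := exists_ratChain_of_isNontrivialClass hK hR hN
    exact hI' hmem 0 hch.const_zero_ne_top
  have hdown : ∀ q ∈ I, ∀ q' ≤ q, q' ∈ I := by
    intro q hq q' hqq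
    obtain ⟨L, hL, bot, top, const, hch, hmem, hne⟩ := hI q hq
    exact hI' hmem q' (hch.const_ne_top_of_le hne hqq)
  have h1 : ∀ q ∈ I, q.1 < 1 := by
    intro q hq
    obtain ⟨L, hL, bot, top, const, hch, hmem, hne⟩ := hI q hq
    refine lt_of_le_of_ne q.2.2 fun heq => hne ?_
    rw [show q = 1 from Subtype.ext heq, hch.const_one]
  have hE := hK
  obtain ⟨E, hE⟩ := hE
  have hV : ∀ B : Alg.{0} RatConst, (∀ ε, Fails B ε → ∃ D ∈ K, Fails D ε) → V {B} ⊆ K := by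
    intro B hB A hA
    rw [hE]
    refine models_iff_not_fails.2 fun ε hε hf => ?_
    obtain ⟨D, hD, hDf⟩ := hB ε (mem_V_singleton.1 hA ε hf)
    rw [hE] at hD
    exact models_iff_not_fails.1 hD ε hε hDf
  by_cases hmax : ∃ q ∈ I, ∀ q' ∈ I, q' ≤ q
  · right
    obtain ⟨p₀, hp₀, hmax⟩ := hmax
    let p : Set.Ico (0 : ℚ) 1 := ⟨p₀.1, p₀.2.1, h1 p₀ hp₀⟩
    have hgt : ∀ {L : Type u} [LinearOrder L] {bot top : L} {const : RatConst → L},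
        chainAlg L bot top const ∈ K → ∀ q : RatConst, p.1 < q.1 → const q = top := by
      intro L _ bot top const hmem q hq
      by_contra hcon
      exact absurd (hmax q (hI' hmem q hcon)) (not_le.2 hq)
    -- The height of `K` above `p` is the least `n` whose height axiom is valid throughout `K`, or
    -- `ω` if none is.
    obtain ⟨γ, hγ1, hγ2⟩ : ∃ γ : ℕ∞,
        (∀ n : ℕ, γ = n → ∀ A ∈ K, ¬ Fails A (axHeight p n).eqOne) ∧
        (∀ n : ℕ, (n : ℕ∞) < γ → ∃ A ∈ K, Fails A (axHeight p n).eqOne) := by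
      by_cases hn : ∃ n : ℕ, ∀ A ∈ K, ¬ Fails A (axHeight p n).eqOne
      · refine ⟨Nat.find hn, fun n h => ?_, fun n h => ?_⟩
        · rw [← Nat.cast_inj.1 h]
          exact Nat.find_spec hn
        · have := Nat.find_min hn (Nat.cast_lt.1 h)
          push Not at this
          exact this
      · push Not at hn
        exact ⟨⊤, fun n h => absurd h (by simp), fun n _ => hn n⟩
    refine ⟨p, γ, Set.Subset.antisymm ?_ (hV _ fun ε hε => ?_)⟩
    · intro A hA
      rw [V_QQ_eq]
      refine ⟨hR hA, models_eqOne_iff.2 ?_⟩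
      rintro _ (⟨q, hq, rfl⟩ | ⟨n, hn, rfl⟩)
      · exact fun hf => absurd (hmax q ⟨A, hA, hf⟩) (not_le.2 hq)
      · exact hγ1 n hn A hA
    · obtain ⟨m, hm, hfail⟩ := exists_card_of_fails_QQ hε
      rcases m with _ | m
      · obtain ⟨L, hL, bot, top, const, hch, hmem, hne⟩ := hI p₀ hp₀
        exact ⟨_, hmem, hfail hch hne (hgt hmem) ∅ (by simp) rfl⟩
      -- To find `m + 1` elements above `c_p`, a failure of the height axiom for `m` suffices. Their
      -- existence also shows that `c_p` is not the top in that chain.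
      · obtain ⟨A, hA, hf⟩ := hγ2 m (lt_of_lt_of_le (Nat.cast_lt.2 (Nat.lt_succ_self m)) hm)
        obtain ⟨L, hL, bot, top, const, hch, hmem, hf⟩ := exists_ratChain_of_fails hK hR hA hf
        have hU := (not_congr (models_axHeight_iff hch p m)).1 (not_not.2 hf)
        push Not at hU
        obtain ⟨U, hU, hcard⟩ := hU
        obtain ⟨W, hWU, hW⟩ := Finset.exists_subset_card_eq (s := U) (n := m + 1) hcard
        obtain ⟨w, hw⟩ : U.Nonempty := Finset.card_pos.1 (by omega)
        exact ⟨_, hmem, hfail hch ((hU hw).1.trans (hU hw).2).ne (hgt hmem) W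
          ((Finset.coe_subset.2 hWU).trans hU) hW⟩
  · left
    push Not at hmax
    let J : Set ℝ := (fun q : RatConst => ((q.1 : ℚ) : ℝ)) '' I
    have hJ1 : ∀ x ∈ J, x ≤ 1 := by
      rintro _ ⟨q, -, rfl⟩
      exact (Rat.cast_le.2 q.2.2).trans Rat.cast_one.le
    have hJb : BddAbove J := ⟨1, hJ1⟩
    -- Without a maximum the supremum is not attained, so `I` consists exactly of the indices
    -- strictly below it.
    have hlt : ∀ q ∈ I, ((q.1 : ℚ) : ℝ) < sSup J := by
      intro q hq
      obtain ⟨q', hq', hqq⟩ := hmax q hq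
      exact lt_of_lt_of_le (Rat.cast_lt.2 hqq) (le_csSup hJb ⟨q', hq', rfl⟩)
    have hge : ∀ q : RatConst, ((q.1 : ℚ) : ℝ) < sSup J → q ∈ I := by
      intro q hq
      obtain ⟨_, ⟨q', hq', rfl⟩, hqq⟩ := exists_lt_of_lt_csSup (s := J) ⟨_, 0, h0, rfl⟩ hq
      exact hdown q' hq' q (le_of_lt (Rat.cast_lt.1 hqq))
    let r : Set.Ioc (0 : ℝ) 1 :=
      ⟨sSup J, by simpa using hlt 0 h0, csSup_le ⟨_, 0, h0, rfl⟩ hJ1⟩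
    refine ⟨r, Set.Subset.antisymm ?_ (hV _ fun ε hε => ?_)⟩
    · intro A hA
      rw [V_Q_eq]
      refine ⟨hR hA, models_eqOne_iff.2 ?_⟩
      rintro _ ⟨q, hq, rfl⟩ hf
      exact absurd (hlt q ⟨A, hA, hf⟩) (not_lt.2 hq)
    · obtain ⟨q₀, hq₀, hfail⟩ := exists_const_of_fails_Q hε
      obtain ⟨L, hL, bot, top, const, hch, hmem, hne⟩ := hI q₀ (hge q₀ hq₀)
      refine ⟨_, hmem, hfail hch hne fun q hq => ?_⟩
      by_contra hcon
      exact absurd (hlt q (hI' hmem q hcon)) (not_lt.2 hq)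

/-! ### Dedekind cuts -/

/-- A bounded below chain with infima and a dense copy of `P` above its least element is the
Dedekind–MacNeille completion of `P` with a new least element. -/
theorem nonempty_orderIso_withBot_dedekindCut {X : Type u} {P : Type v} [PartialOrder X]
    [PartialOrder P] {p₀ : P} (hp₀ : ∀ p, p₀ ≤ p) {b : X} (hb : ∀ x, b ≤ x) (htotal : ∀ x y : X, x ≤ y ∨ y ≤ x)
    {g : P → X} (hg : ∀ p q, g p ≤ g q ↔ p ≤ q) (hgb : ∀ p, g p ≠ b)
    (hinf : ∀ S : Set P, ∃ k, IsGLB (g '' S) k)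
    (hjoin : ∀ x y, x ≠ b → x < y → ∃ p, x < g p ∧ g p ≤ y)
    (hmeet : ∀ x y, x ≠ b → x < y → ∃ p, x ≤ g p ∧ g p < y) :
    Nonempty (X ≃o WithBot (DedekindCut P)) := by
  classical
  have hlt : ∀ x y : X, ¬ x ≤ y → y < x := fun x y h =>
    lt_of_le_not_ge ((htotal x y).resolve_left h) h
  -- Join-density makes the upper bounds of the lower part equal to the upper part, and meet-density
  -- gives the converse.
  let cut : ∀ x : X, x ≠ b → DedekindCut P := fun x hx =>
    { extent := {p | g p ≤ x}
      intent := {p | x ≤ g p}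
      upperPolar_extent := by
        refine Set.Subset.antisymm (fun q hq => ?_) fun q hq p hp => (hg _ _).1 (le_trans hp hq)
        by_contra hcon
        obtain ⟨p, hp, hpx⟩ := hjoin _ _ (hgb q) (hlt _ _ hcon)
        exact absurd ((hg _ _).2 (hq hpx)) hp.not_ge
      lowerPolar_intent := by
        refine Set.Subset.antisymm (fun p hp => ?_) fun p hp q hq => (hg _ _).1 (le_trans hp hq)
        by_contra hcon
        obtain ⟨q, hxq, hq⟩ := hmeet _ _ hx (hlt _ _ hcon)
        exact absurd ((hg _ _).2 (hp hxq)) hq.not_ge }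
  have hcut : ∀ x y hx hy, cut x hx ≤ cut y hy ↔ x ≤ y := by
    intro x y hx hy
    rw [← Concept.extent_subset_extent_iff]
    refine ⟨fun h => ?_, fun h p hp => le_trans hp h⟩
    by_contra hcon
    obtain ⟨p, hp, hpx⟩ := hjoin _ _ hy (hlt _ _ hcon)
    exact absurd (h hpx) hp.not_ge
  let F : X → WithBot (DedekindCut P) := fun x => if hx : x = b then ⊥ else (cut x hx : _)
  have hFb : F b = ⊥ := dif_pos rfl
  have hFn : ∀ x (hx : x ≠ b), F x = (cut x hx : WithBot (DedekindCut P)) := fun x hx => dif_neg hx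
  have hF : ∀ x y, F x ≤ F y ↔ x ≤ y := by
    intro x y
    by_cases hx : x = b
    · subst hx
      simp [hFb, hb]
    by_cases hy : y = b
    · subst hy
      rw [hFb, hFn x hx, le_bot_iff]
      exact ⟨fun h => absurd h WithBot.coe_ne_bot, fun h => absurd (le_antisymm h (hb x)) hx⟩
    · rw [hFn x hx, hFn y hy, WithBot.coe_le_coe, hcut x y hx hy]
  have hsurj : Function.Surjective F := by
    intro c
    induction c using WithBot.recBotCoe with
    | bot => exact ⟨b, hFb⟩
    | coe c =>
      obtain ⟨k, hk⟩ := hinf c.intent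
      -- The least element of `P` keeps the infimum away from `b`; without it the empty cut could
      -- compete with the new bottom.
      have hkb : k ≠ b := by
        intro h
        have h1 : g p₀ ≤ k := hk.2 (by
          rintro _ ⟨p, -, rfl⟩
          exact (hg _ _).2 (hp₀ p))
        exact hgb p₀ (le_antisymm (h ▸ h1) (hb _))
      refine ⟨k, (hFn k hkb).trans (congrArg _ (Concept.ext ?_))⟩
      rw [← c.lowerPolar_intent]
      refine Set.Subset.antisymm (fun p hp q hq => (hg _ _).1 (le_trans hp (hk.1 ⟨q, hq, rfl⟩)))
        fun p hp => hk.2 ?_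
      rintro _ ⟨q, hq, rfl⟩
      exact (hg _ _).2 (hp hq)
  exact ⟨OrderIso.ofSurjective (OrderEmbedding.ofMapLEIff F hF) hsurj⟩

/-! ### The poset of subvarieties -/

/-- The variety generated by `Q r`, as a subvariety. -/
def VQ (r : Set.Ioc (0 : ℝ) 1) : Subvariety.{u} :=
  ⟨V {Q r}, isVariety_V _, V_subset_RGA (Q_mem_RGA r)⟩

/-- The variety generated by `QQ p γ`, as a subvariety. -/
def VQQ (p : Set.Ico (0 : ℚ) 1) (γ : ℕ∞) : Subvariety.{u} :=
  ⟨V {QQ p γ}, isVariety_V _, V_subset_RGA (QQ_mem_RGA p γ)⟩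

/-- The trivial variety. -/
def trivialSubvariety : Subvariety.{u} :=
  ⟨{A | A ∈ RGA ∧ A.Models {⟨.var 0, .var 1⟩}}, isVariety_models isVariety_RGA _, fun _ h => h.1⟩

theorem VQ_le_VQ {r s : Set.Ioc (0 : ℝ) 1} : (VQ r : Subvariety.{u}) ≤ VQ s ↔ r ≤ s :=
  V_Q_subset_V_Q

theorem VQ_le_VQQ {r : Set.Ioc (0 : ℝ) 1} {p : Set.Ico (0 : ℚ) 1} {γ : ℕ∞} :
    (VQ r : Subvariety.{u}) ≤ VQQ p γ ↔ (r : ℝ) ≤ ((p : ℚ) : ℝ) := V_Q_subset_V_QQ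

theorem VQQ_le_VQ {r : Set.Ioc (0 : ℝ) 1} {p : Set.Ico (0 : ℚ) 1} {γ : ℕ∞} :
    (VQQ p γ : Subvariety.{u}) ≤ VQ r ↔ ((p : ℚ) : ℝ) < (r : ℝ) := V_QQ_subset_V_Q

theorem VQQ_le_VQQ {p₁ p₂ : Set.Ico (0 : ℚ) 1} {γ₁ γ₂ : ℕ∞} :
    (VQQ p₁ γ₁ : Subvariety.{u}) ≤ VQQ p₂ γ₂ ↔ p₁ < p₂ ∨ (p₁ = p₂ ∧ γ₁ ≤ γ₂) :=
  V_QQ_subset_V_QQ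

theorem models_of_not_isNontrivialClass {K : Set (Alg.{u} RatConst)} (hN : ¬ IsNontrivialClass K)
    {A : Alg.{u} RatConst} (hA : A ∈ K) (E : Set (Equation RatConst)) : A.Models E := by
  intro ε _ e
  by_contra hne
  exact hN ⟨A, hA, _, _, hne⟩

theorem not_isNontrivialClass_trivialSubvariety :
    ¬ IsNontrivialClass (trivialSubvariety : Subvariety.{u}).1 := by
  rintro ⟨A, hA, x, y, hxy⟩
  exact hxy (hA.2 _ rfl (assign x y y))

theorem le_of_not_isNontrivialClass {K : Subvariety.{u}} (hN : ¬ IsNontrivialClass K.1)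
    (K' : Subvariety.{u}) : K ≤ K' := by
  obtain ⟨K', ⟨E, rfl⟩, hR⟩ := K'
  exact fun A hA => models_of_not_isNontrivialClass hN hA E

theorem trivialSubvariety_le (K : Subvariety.{u}) : trivialSubvariety ≤ K :=
  le_of_not_isNontrivialClass not_isNontrivialClass_trivialSubvariety K

theorem isNontrivialClass_iff_ne {K : Subvariety.{u}} :
    IsNontrivialClass K.1 ↔ K ≠ trivialSubvariety := by
  refine ⟨?_, fun h => ?_⟩
  · rintro h rfl
    exact not_isNontrivialClass_trivialSubvariety h
  · by_contra hN
    exact h (le_antisymm (le_of_not_isNontrivialClass hN _) (trivialSubvariety_le K))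

theorem VQ_ne_trivialSubvariety (r : Set.Ioc (0 : ℝ) 1) :
    (VQ r : Subvariety.{u}) ≠ trivialSubvariety := by
  refine isNontrivialClass_iff_ne.1 ⟨_, ulift_mem_V, ⟨qBot r⟩, ⟨qTop r⟩, fun h => ?_⟩
  exact (isRatChain_Q r).bot_ne_top (congrArg ULift.down h)

theorem VQQ_ne_trivialSubvariety (p : Set.Ico (0 : ℚ) 1) (γ : ℕ∞) :
    (VQQ p γ : Subvariety.{u}) ≠ trivialSubvariety := by
  refine isNontrivialClass_iff_ne.1 ⟨_, ulift_mem_V, ⟨qqBot p γ⟩, ⟨(⊤ : QQCarrier p γ)⟩, fun h => ?_⟩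
  exact (isRatChain_QQ p γ).bot_ne_top (congrArg ULift.down h)

theorem Subvariety.eq_VQ_or_eq_VQQ {K : Subvariety.{u}} (hK : K ≠ trivialSubvariety) :
    (∃ r, K = VQ r) ∨ ∃ p γ, K = VQQ p γ := by
  rcases eq_V_Q_or_eq_V_QQ K.2.1 K.2.2 (isNontrivialClass_iff_ne.2 hK) with ⟨r, h⟩ | ⟨p, γ, h⟩
  · exact Or.inl ⟨r, Subtype.ext h⟩
  · exact Or.inr ⟨p, γ, Subtype.ext h⟩

theorem Subvariety.le_total (K₁ K₂ : Subvariety.{u}) : K₁ ≤ K₂ ∨ K₂ ≤ K₁ := by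
  by_cases h1 : K₁ = trivialSubvariety
  · exact Or.inl (h1 ▸ trivialSubvariety_le K₂)
  by_cases h2 : K₂ = trivialSubvariety
  · exact Or.inr (h2 ▸ trivialSubvariety_le K₁)
  rcases Subvariety.eq_VQ_or_eq_VQQ h1 with ⟨r, rfl⟩ | ⟨p, γ, rfl⟩ <;>
    rcases Subvariety.eq_VQ_or_eq_VQQ h2 with ⟨s, rfl⟩ | ⟨q, δ, rfl⟩
  · rw [VQ_le_VQ, VQ_le_VQ]
    exact _root_.le_total r s
  · rw [VQ_le_VQQ, VQQ_le_VQ]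
    exact le_or_gt _ _
  · rw [VQ_le_VQQ, VQQ_le_VQ]
    exact lt_or_ge _ _
  · rw [VQQ_le_VQQ, VQQ_le_VQQ]
    rcases lt_trichotomy p q with h | rfl | h
    · exact Or.inl (Or.inl h)
    · simpa using _root_.le_total γ δ
    · exact Or.inr (Or.inl h)

theorem Subvariety.lt_iff_not_le {K₁ K₂ : Subvariety.{u}} : K₁ < K₂ ↔ ¬ K₂ ≤ K₁ :=
  ⟨not_le_of_gt, fun h => lt_of_le_not_ge ((Subvariety.le_total K₁ K₂).resolve_right h) h⟩

theorem VQ_lt_VQ {r s : Set.Ioc (0 : ℝ) 1} : (VQ r : Subvariety.{u}) < VQ s ↔ r < s := by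
  rw [Subvariety.lt_iff_not_le, VQ_le_VQ, not_le]

theorem VQ_lt_VQQ {r : Set.Ioc (0 : ℝ) 1} {p : Set.Ico (0 : ℚ) 1} {γ : ℕ∞} :
    (VQ r : Subvariety.{u}) < VQQ p γ ↔ (r : ℝ) ≤ ((p : ℚ) : ℝ) := by
  rw [Subvariety.lt_iff_not_le, VQQ_le_VQ, not_lt]

theorem VQQ_lt_VQ {r : Set.Ioc (0 : ℝ) 1} {p : Set.Ico (0 : ℚ) 1} {γ : ℕ∞} :
    (VQQ p γ : Subvariety.{u}) < VQ r ↔ ((p : ℚ) : ℝ) < (r : ℝ) := by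
  rw [Subvariety.lt_iff_not_le, VQ_le_VQQ, not_le]

theorem VQ_injective : Function.Injective (VQ : Set.Ioc (0 : ℝ) 1 → Subvariety.{u}) :=
  fun _ _ h => le_antisymm (VQ_le_VQ.1 h.le) (VQ_le_VQ.1 h.ge)

theorem uncountable_subvariety : Uncountable Subvariety.{u} := by
  have : Uncountable (Set.Ioc (0 : ℝ) 1) := by
    rw [← not_countable_iff]
    intro h
    exact absurd (Cardinal.Real.Ioc_countable_iff.1 (Set.countable_coe_iff.1 h)) (by norm_num)
  exact VQ_injective.uncountable

/-- The infimum is axiomatized, inside `RGA`, by the union of the defining equations. -/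
theorem Subvariety.exists_isGLB (S : Set Subvariety.{u}) : ∃ K, IsGLB S K := by
  choose E hE using fun K : Subvariety.{u} => K.2.1
  refine ⟨⟨{A | A ∈ RGA ∧ A.Models (⋃ K ∈ S, E K)}, isVariety_models isVariety_RGA _,
    fun _ h => h.1⟩, fun K hK A hA => ?_, fun K hK A hA => ⟨K.2.2 hA, fun ε hε => ?_⟩⟩
  · rw [hE K]
    exact fun ε hε => hA.2 ε (Set.mem_biUnion hK hε)
  · obtain ⟨K', hK', hε⟩ := Set.mem_iUnion₂.1 hε
    have := hK hK' hA
    rw [hE K'] at this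
    exact this ε hε

/-- A positive rational in `[0, 1)` as a real in `(0, 1]`. -/
def toIoc (p : Set.Ico (0 : ℚ) 1) (hp : p.1 ≠ 0) : Set.Ioc (0 : ℝ) 1 :=
  ⟨p.1, by exact_mod_cast lt_of_le_of_ne p.2.1 hp.symm, by exact_mod_cast p.2.2.le⟩

open Classical in
/-- A dense embedding of the lexicographic order into the poset of subvarieties. The variety of
`Q p` precedes those of the `QQ p γ` for `p ≠ 0`. -/
noncomputable def lexToSubvariety (x : LexPoset) : Subvariety.{u} :=
  if h : (ofLex x).1.1 = 0 then VQQ (ofLex x).1 (ofLex x).2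
  else if (ofLex x).2 = 0 then VQ (toIoc (ofLex x).1 h)
  else VQQ (ofLex x).1 ((ofLex x).2 - 1)

theorem lexToSubvariety_of_eq_zero {p : Set.Ico (0 : ℚ) 1} (hp : p.1 = 0) (γ : ℕ∞) :
    (lexToSubvariety (toLex (p, γ)) : Subvariety.{u}) = VQQ p γ := dif_pos hp

theorem lexToSubvariety_zero {p : Set.Ico (0 : ℚ) 1} (hp : p.1 ≠ 0) :
    (lexToSubvariety (toLex (p, 0)) : Subvariety.{u}) = VQ (toIoc p hp) :=
  (dif_neg hp).trans (if_pos rfl)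

theorem lexToSubvariety_of_ne_zero {p : Set.Ico (0 : ℚ) 1} (hp : p.1 ≠ 0) {γ : ℕ∞} (hγ : γ ≠ 0) :
    (lexToSubvariety (toLex (p, γ)) : Subvariety.{u}) = VQQ p (γ - 1) :=
  (dif_neg hp).trans (if_neg hγ)

/-- For `p ≠ 0` the slot 0 is taken by `Q p`, which shifts the `QQ p γ` by one. The shift is
absorbed at the end, since `⊤ + 1 = ⊤` in `ℕ∞`. -/
theorem lexToSubvariety_add_one {p : Set.Ico (0 : ℚ) 1} (hp : p.1 ≠ 0) (γ : ℕ∞) :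
    (lexToSubvariety (toLex (p, γ + 1)) : Subvariety.{u}) = VQQ p γ := by
  rw [lexToSubvariety_of_ne_zero hp (by simp)]
  exact congrArg (VQQ p)
    (ENat.addLECancellable_of_ne_top ENat.one_ne_top).add_tsub_cancel_right

theorem lexToSubvariety_top (p : Set.Ico (0 : ℚ) 1) :
    (lexToSubvariety (toLex (p, ⊤)) : Subvariety.{u}) = VQQ p ⊤ := by
  by_cases hp : p.1 = 0
  · exact lexToSubvariety_of_eq_zero hp ⊤
  · exact lexToSubvariety_add_one hp ⊤

theorem lexToSubvariety_le_VQQ_top (p : Set.Ico (0 : ℚ) 1) (γ : ℕ∞) :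
    (lexToSubvariety (toLex (p, γ)) : Subvariety.{u}) ≤ VQQ p ⊤ := by
  by_cases hp : p.1 = 0
  · rw [lexToSubvariety_of_eq_zero hp, VQQ_le_VQQ]
    exact Or.inr ⟨rfl, le_top⟩
  by_cases hγ : γ = 0
  · rw [hγ, lexToSubvariety_zero hp, VQ_le_VQQ]
    exact le_rfl
  · rw [lexToSubvariety_of_ne_zero hp hγ, VQQ_le_VQQ]
    exact Or.inr ⟨rfl, le_top⟩

theorem VQ_le_lexToSubvariety {p : Set.Ico (0 : ℚ) 1} (hp : p.1 ≠ 0) (γ : ℕ∞) :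
    VQ (toIoc p hp) ≤ (lexToSubvariety (toLex (p, γ)) : Subvariety.{u}) := by
  by_cases hγ : γ = 0
  · rw [hγ, lexToSubvariety_zero hp]
  · rw [lexToSubvariety_of_ne_zero hp hγ, VQ_le_VQQ]
    exact le_rfl

/-- The block of `p` ends with `QQ p ⊤`, which lies strictly below `Q q`, the start of the block of
`q`. -/
theorem lexToSubvariety_lt_of_lt {p q : Set.Ico (0 : ℚ) 1} (h : p < q) (γ δ : ℕ∞) :
    (lexToSubvariety (toLex (p, γ)) : Subvariety.{u}) < lexToSubvariety (toLex (q, δ)) := by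
  have hq : q.1 ≠ 0 := (lt_of_le_of_lt p.2.1 h).ne'
  refine (lexToSubvariety_le_VQQ_top p γ).trans_lt
    (lt_of_lt_of_le (VQQ_lt_VQ.2 ?_) (VQ_le_lexToSubvariety hq δ))
  exact Rat.cast_lt.2 h

theorem lexToSubvariety_le_iff (x y : LexPoset) :
    (lexToSubvariety x : Subvariety.{u}) ≤ lexToSubvariety y ↔ x ≤ y := by
  obtain ⟨p, γ⟩ := x
  obtain ⟨q, δ⟩ := y
  change (lexToSubvariety (toLex (p, γ)) : Subvariety.{u}) ≤ lexToSubvariety (toLex (q, δ)) ↔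
    toLex (p, γ) ≤ toLex (q, δ)
  rw [Prod.Lex.toLex_le_toLex]
  rcases lt_trichotomy p q with h | rfl | h
  · exact iff_of_true (lexToSubvariety_lt_of_lt h _ _).le (Or.inl h)
  · simp only [lt_self_iff_false, true_and, false_or]
    by_cases hp : p.1 = 0
    · rw [lexToSubvariety_of_eq_zero hp, lexToSubvariety_of_eq_zero hp, VQQ_le_VQQ]
      simp
    by_cases hγ : γ = 0
    · rw [hγ, lexToSubvariety_zero hp]
      exact iff_of_true (VQ_le_lexToSubvariety hp δ) zero_le
    by_cases hδ : δ = 0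
    · rw [hδ, lexToSubvariety_zero hp, lexToSubvariety_of_ne_zero hp hγ, VQQ_le_VQ]
      exact iff_of_false (lt_irrefl _) (by simpa using hγ)
    · rw [lexToSubvariety_of_ne_zero hp hγ, lexToSubvariety_of_ne_zero hp hδ, VQQ_le_VQQ]
      simp only [lt_self_iff_false, true_and, false_or]
      rw [tsub_le_iff_right, tsub_add_cancel_of_le (Order.one_le_iff_ne_zero.2 hδ)]
  · refine iff_of_false (lexToSubvariety_lt_of_lt h _ _).not_ge ?_
    rintro (h' | ⟨h', -⟩)
    · exact absurd h h'.not_gt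
    · exact h.ne' h'

theorem lexToSubvariety_ne (x : LexPoset) :
    (lexToSubvariety x : Subvariety.{u}) ≠ trivialSubvariety := by
  unfold lexToSubvariety
  split_ifs
  exacts [VQQ_ne_trivialSubvariety _ _, VQ_ne_trivialSubvariety _, VQQ_ne_trivialSubvariety _ _]

theorem exists_lexToSubvariety_eq (p : Set.Ico (0 : ℚ) 1) (γ : ℕ∞) :
    ∃ x, (lexToSubvariety x : Subvariety.{u}) = VQQ p γ := by
  by_cases hp : p.1 = 0
  · exact ⟨_, lexToSubvariety_of_eq_zero hp γ⟩
  · exact ⟨_, lexToSubvariety_add_one hp γ⟩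

theorem exists_Ico_btwn {a b : ℝ} (ha : 0 ≤ a) (hb : b ≤ 1) (hab : a < b) :
    ∃ q : Set.Ico (0 : ℚ) 1, a < (q.1 : ℝ) ∧ (q.1 : ℝ) < b := by
  obtain ⟨q, h1, h2⟩ := exists_rat_btwn hab
  exact ⟨⟨q, by exact_mod_cast ha.trans h1.le, by exact_mod_cast h2.trans_le hb⟩, h1, h2⟩

/-- If `K'` is some `QQ q δ`, it is itself in the image. Otherwise it is a `Q s`, and some `QQ q ⊤`
with rational `q < s` fits in between. -/
theorem exists_lexToSubvariety_btwn_left {K K' : Subvariety.{u}} (hK : K ≠ trivialSubvariety)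
    (h : K < K') : ∃ x, K < lexToSubvariety x ∧ lexToSubvariety x ≤ K' := by
  have hK' : K' ≠ trivialSubvariety := fun hh => absurd (trivialSubvariety_le K) (hh ▸ h.not_ge)
  rcases Subvariety.eq_VQ_or_eq_VQQ hK' with ⟨s, rfl⟩ | ⟨q, δ, rfl⟩
  · rcases Subvariety.eq_VQ_or_eq_VQQ hK with ⟨r, rfl⟩ | ⟨p, γ, rfl⟩
    · obtain ⟨q, h1, h2⟩ := exists_Ico_btwn r.2.1.le s.2.2 (VQ_lt_VQ.1 h)
      refine ⟨toLex (q, ⊤), ?_⟩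
      rw [lexToSubvariety_top, VQ_lt_VQQ, VQQ_le_VQ]
      exact ⟨h1.le, h2⟩
    · obtain ⟨q, h1, h2⟩ := exists_Ico_btwn (by exact_mod_cast p.2.1) s.2.2 (VQQ_lt_VQ.1 h)
      have h3 : p < q := by exact_mod_cast h1
      refine ⟨toLex (q, ⊤), ?_⟩
      rw [lexToSubvariety_top, VQQ_le_VQ, Subvariety.lt_iff_not_le, VQQ_le_VQQ]
      refine ⟨?_, h2⟩
      rintro (h4 | ⟨rfl, -⟩)
      · exact absurd h3 h4.not_gt
      · exact lt_irrefl _ h3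
  · obtain ⟨x, hx⟩ := exists_lexToSubvariety_eq q δ
    exact ⟨x, hx ▸ h, hx.le⟩

theorem exists_lexToSubvariety_btwn_right {K K' : Subvariety.{u}} (hK : K ≠ trivialSubvariety)
    (h : K < K') : ∃ x, K ≤ lexToSubvariety x ∧ lexToSubvariety x < K' := by
  have hK' : K' ≠ trivialSubvariety := fun hh => absurd (trivialSubvariety_le K) (hh ▸ h.not_ge)
  rcases Subvariety.eq_VQ_or_eq_VQQ hK with ⟨r, rfl⟩ | ⟨p, γ, rfl⟩
  · rcases Subvariety.eq_VQ_or_eq_VQQ hK' with ⟨s, rfl⟩ | ⟨p, γ, rfl⟩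
    · obtain ⟨q, h1, h2⟩ := exists_Ico_btwn r.2.1.le s.2.2 (VQ_lt_VQ.1 h)
      refine ⟨toLex (q, ⊤), ?_⟩
      rw [lexToSubvariety_top, VQ_le_VQQ, VQQ_lt_VQ]
      exact ⟨h1.le, h2⟩
    · rcases (VQ_lt_VQQ.1 h).lt_or_eq with hlt | heq
      · obtain ⟨q, h1, h2⟩ := exists_Ico_btwn r.2.1.le (by exact_mod_cast p.2.2.le) hlt
        have h3 : q < p := by exact_mod_cast h2
        refine ⟨toLex (q, ⊤), ?_⟩
        rw [lexToSubvariety_top, VQ_le_VQQ, Subvariety.lt_iff_not_le, VQQ_le_VQQ]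
        refine ⟨h1.le, ?_⟩
        rintro (h4 | ⟨rfl, -⟩)
        · exact absurd h3 h4.not_gt
        · exact lt_irrefl _ h3
      -- Here `r = p` is rational, so `Q r` is in the image itself, as the first element of the
      -- block of `p`.
      · have hp : p.1 ≠ 0 := by
          have h1 := r.2.1
          rw [heq] at h1
          exact_mod_cast h1.ne'
        obtain rfl : r = toIoc p hp := Subtype.ext heq
        exact ⟨toLex (p, 0), (lexToSubvariety_zero hp).ge, (lexToSubvariety_zero hp).trans_lt h⟩
  · obtain ⟨x, hx⟩ := exists_lexToSubvariety_eq p γ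
    exact ⟨x, hx.ge, hx.trans_lt h⟩

theorem nonempty_orderIso_subvariety :
    Nonempty (Subvariety.{u} ≃o WithBot (DedekindCut LexPoset)) := by
  refine nonempty_orderIso_withBot_dedekindCut
    (p₀ := toLex ((⟨0, le_rfl, one_pos⟩ : Set.Ico (0 : ℚ) 1), (0 : ℕ∞))) (fun x => ?_)
    trivialSubvariety_le Subvariety.le_total lexToSubvariety_le_iff lexToSubvariety_ne
    (fun S => Subvariety.exists_isGLB _) (fun _ _ => exists_lexToSubvariety_btwn_left)
    (fun _ _ => exists_lexToSubvariety_btwn_right)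
  obtain ⟨p, γ⟩ := x
  change _ ≤ toLex (p, γ)
  rw [Prod.Lex.toLex_le_toLex]
  exact (show (⟨0, le_rfl, one_pos⟩ : Set.Ico (0 : ℚ) 1) ≤ p from p.2.1).lt_or_eq.imp_right
    fun h => ⟨h, zero_le⟩

/-! ### Rational Gödel logic -/

theorem Fm.eval_subst {A : Alg.{u} RatConst} (σ : ℕ → Fm RatConst) (e : ℕ → A.carrier)
    (φ : Fm RatConst) : (φ.subst σ).eval A e = φ.eval A (fun n => (σ n).eval A e) := by
  induction φ with
  | var n => rfl
  | const c => rfl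
  | zero => rfl
  | one => rfl
  | meet s t hs ht => exact congrArg₂ A.meet hs ht
  | join s t hs ht => exact congrArg₂ A.join hs ht
  | mul s t hs ht => exact congrArg₂ A.mul hs ht
  | imp s t hs ht => exact congrArg₂ A.imp hs ht

theorem Fm.subst_var (φ : Fm RatConst) : φ.subst .var = φ := by
  induction φ <;> simp_all [Fm.subst]

theorem fails_of_fails_subst {A : Alg.{u} RatConst} {σ : ℕ → Fm RatConst} {φ : Fm RatConst}
    (h : Fails A (φ.subst σ).eqOne) : Fails A φ.eqOne := by
  obtain ⟨e, he⟩ := h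
  refine ⟨fun n => (σ n).eval A e, fun h => he ?_⟩
  exact (Fm.eval_subst σ e φ).trans h

/-- This turns equations into formulas, so subvarieties are determined by the formulas they
validate. -/
theorem eval_iff_eq_one_iff {A : Alg.{u} RatConst} (hA : A ∈ RGA) (e : ℕ → A.carrier)
    (s t : Fm RatConst) : (Fm.iff s t).eval A e = A.one ↔ s.eval A e = t.eval A e := by
  let _ := godelHeyting hA.1
  change (s.eval A e ⇨ t.eval A e) ⊓ (t.eval A e ⇨ s.eval A e) = ⊤ ↔ _
  rw [inf_eq_top_iff, himp_eq_top_iff, himp_eq_top_iff]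
  exact ⟨fun h => le_antisymm h.1 h.2, fun h => ⟨h.le, h.ge⟩⟩

theorem isLogic_RG : IsLogic RG.{u} where
  refl Γ φ hφ := ⟨{φ}, Set.singleton_subset_iff.2 hφ, Set.finite_singleton _,
    fun _ _ _ h => h φ rfl⟩
  mono := by
    rintro Γ Γ' φ h ⟨Δ, hΔ, hfin, hh⟩
    exact ⟨Δ, hΔ.trans h, hfin, hh⟩
  cut := by
    rintro Γ Γ' φ h ⟨Δ, hΔ, hfin, hh⟩
    choose! F hF hFfin hFh using h
    refine ⟨⋃ δ ∈ Δ, F δ, Set.iUnion₂_subset fun δ hδ => hF δ (hΔ hδ),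
      hfin.biUnion fun δ hδ => hFfin δ (hΔ hδ), fun A hA e he => hh A hA e fun δ hδ => ?_⟩
    exact hFh δ (hΔ hδ) A hA e fun ψ hψ => he ψ (Set.mem_biUnion hδ hψ)
  subst := by
    rintro σ Γ φ ⟨Δ, hΔ, hfin, hh⟩
    refine ⟨Fm.subst σ '' Δ, Set.image_mono hΔ, hfin.image _, fun A hA e he => ?_⟩
    rw [Fm.eval_subst]
    refine hh A hA _ fun δ hδ => ?_
    rw [← Fm.eval_subst]
    exact he _ ⟨δ, hδ, rfl⟩
  finitary := by
    rintro Γ φ ⟨Δ, hΔ, hfin, hh⟩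
    exact ⟨Δ, hΔ, hfin, Δ, Set.Subset.rfl, hfin, hh⟩

/-! ### The Lindenbaum algebra -/

/-- Sets of formulas closed under substitutions. -/
def SubstClosed (S : Set (Fm RatConst)) : Prop :=
  ∀ σ : ℕ → Fm RatConst, ∀ φ ∈ S, φ.subst σ ∈ S

/-- The equation `s ≈ t` follows from the equations `δ ≈ 1` with `δ ∈ S`. -/
def EqEntails (S : Set (Fm RatConst)) (s t : Fm RatConst) : Prop :=
  ∃ Δ ⊆ S, Δ.Finite ∧ ∀ A ∈ RGA.{u}, ∀ e : ℕ → A.carrier,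
    (∀ δ ∈ Δ, δ.eval A e = A.one) → s.eval A e = t.eval A e

theorem EqEntails.of_eq {S : Set (Fm RatConst)} {s t : Fm RatConst}
    (h : ∀ A ∈ RGA.{u}, ∀ e : ℕ → A.carrier, s.eval A e = t.eval A e) : EqEntails.{u} S s t :=
  ⟨∅, Set.empty_subset _, Set.finite_empty, fun A hA e _ => h A hA e⟩

theorem EqEntails.congr {S : Set (Fm RatConst)} {s t s' t' s'' t'' : Fm RatConst}
    (h : EqEntails.{u} S s t) (h' : EqEntails.{u} S s' t')
    (hcongr : ∀ A ∈ RGA.{u}, ∀ e : ℕ → A.carrier, s.eval A e = t.eval A e →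
      s'.eval A e = t'.eval A e → s''.eval A e = t''.eval A e) : EqEntails.{u} S s'' t'' := by
  obtain ⟨Δ, hΔ, hfin, hh⟩ := h
  obtain ⟨Δ', hΔ', hfin', hh'⟩ := h'
  exact ⟨Δ ∪ Δ', Set.union_subset hΔ hΔ', hfin.union hfin', fun A hA e he => hcongr A hA e
    (hh A hA e fun δ hδ => he δ (Or.inl hδ)) (hh' A hA e fun δ hδ => he δ (Or.inr hδ))⟩

/-- Equality of formulas modulo `S`. -/
def lindenbaumSetoid (S : Set (Fm RatConst)) : Setoid (Fm RatConst) where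
  r := EqEntails.{u} S
  iseqv :=
    { refl := fun _ => .of_eq fun _ _ _ => rfl
      symm := fun h => h.congr h fun _ _ _ h _ => h.symm
      trans := fun h h' => h.congr h' fun _ _ _ h h' => h.trans h' }

/-- The algebra of formulas modulo `S`. -/
def lindenbaum (S : Set (Fm RatConst)) : Alg.{0} RatConst where
  carrier := Quotient (lindenbaumSetoid.{u} S)
  meet := Quotient.map₂ .meet fun _ _ h _ _ h' =>
    EqEntails.congr h h' fun A _ _ h h' => congrArg₂ A.meet h h'
  join := Quotient.map₂ .join fun _ _ h _ _ h' =>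
    EqEntails.congr h h' fun A _ _ h h' => congrArg₂ A.join h h'
  mul := Quotient.map₂ .mul fun _ _ h _ _ h' =>
    EqEntails.congr h h' fun A _ _ h h' => congrArg₂ A.mul h h'
  imp := Quotient.map₂ .imp fun _ _ h _ _ h' =>
    EqEntails.congr h h' fun A _ _ h h' => congrArg₂ A.imp h h'
  zero := Quotient.mk _ .zero
  one := Quotient.mk _ .one
  const c := Quotient.mk _ (.const c)

theorem eval_lindenbaum (S : Set (Fm RatConst)) (σ : ℕ → Fm RatConst) (φ : Fm RatConst) :
    φ.eval (lindenbaum.{u} S) (fun n => Quotient.mk _ (σ n)) = Quotient.mk _ (φ.subst σ) := by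
  induction φ with
  | var n => rfl
  | const c => rfl
  | zero => rfl
  | one => rfl
  | meet s t hs ht => exact congrArg₂ (lindenbaum.{u} S).meet hs ht
  | join s t hs ht => exact congrArg₂ (lindenbaum.{u} S).join hs ht
  | mul s t hs ht => exact congrArg₂ (lindenbaum.{u} S).mul hs ht
  | imp s t hs ht => exact congrArg₂ (lindenbaum.{u} S).imp hs ht

theorem fails_lindenbaum_iff {S : Set (Fm RatConst)} {ε : Equation RatConst} :
    Fails (lindenbaum.{u} S) ε ↔
      ∃ σ, ¬ EqEntails.{u} S (ε.lhs.subst σ) (ε.rhs.subst σ) := by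
  constructor
  · rintro ⟨e, he⟩
    choose σ hσ using fun n => Quotient.exists_rep (e n)
    obtain rfl : (fun n => Quotient.mk _ (σ n)) = e := funext hσ
    rw [eval_lindenbaum, eval_lindenbaum] at he
    exact ⟨σ, fun h => he (Quotient.sound h)⟩
  · rintro ⟨σ, hσ⟩
    refine ⟨fun n => Quotient.mk _ (σ n), fun h => hσ ?_⟩
    rw [eval_lindenbaum, eval_lindenbaum] at h
    exact Quotient.exact h

/-- Assignments into the formula algebra are substitutions, and substitution instances of the axioms
of `RGA` hold in all its members without any premises. -/
theorem lindenbaum_mem_RGA (S : Set (Fm RatConst)) : lindenbaum.{u} S ∈ RGA := by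
  rw [mem_RGA_iff, models_iff_not_fails]
  intro ε hε hf
  obtain ⟨σ, hσ⟩ := fails_lindenbaum_iff.1 hf
  refine hσ (.of_eq fun A hA e => ?_)
  rw [Fm.eval_subst, Fm.eval_subst]
  exact mem_RGA_iff.1 hA ε hε _

/-- Completeness of rational Gödel logic over sets of formulas closed under substitutions. -/
theorem RG_iff_forall_not_fails {S : Set (Fm RatConst)} (hS : SubstClosed S) {φ : Fm RatConst} :
    RG.{u} S φ ↔ ∀ A ∈ RGA.{u}, A.Models (eqOne S) → ¬ Fails A φ.eqOne := by
  constructor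
  · rintro ⟨Δ, hΔ, -, h⟩ A hA hAS ⟨e, he⟩
    exact he (h A hA e fun δ hδ => hAS ⟨δ, .one⟩ ⟨δ, hΔ hδ, rfl⟩ e)
  · intro h
    by_contra hφ
    -- The identity substitution refutes an underivable `φ` in the Lindenbaum algebra. Closure of
    -- `S` under substitutions is what makes this algebra a model of `S`.
    refine h (Alg.ulift.{u} (lindenbaum.{u} S)) ?_ ?_ (fails_ulift.2 (fails_lindenbaum_iff.2
      ⟨.var, fun hh => hφ ?_⟩))
    · rw [mem_RGA_iff, models_iff_not_fails]
      intro ε hε hf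
      exact models_iff_not_fails.1 (mem_RGA_iff.1 (lindenbaum_mem_RGA S)) ε hε (fails_ulift.1 hf)
    · rw [models_eqOne_iff]
      intro ψ hψ hf
      obtain ⟨σ, hσ⟩ := fails_lindenbaum_iff.1 (fails_ulift.1 hf)
      exact hσ ⟨{ψ.subst σ}, Set.singleton_subset_iff.2 (hS σ ψ hψ), Set.finite_singleton _,
        fun _ _ _ he => he _ rfl⟩
    · rw [show φ.eqOne.lhs = φ from rfl, Fm.subst_var] at hh
      exact hh

/-! ### Axiomatic extensions -/

theorem isAxiomaticExtension_of_substClosed {S : Set (Fm RatConst)} (hS : SubstClosed S) :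
    IsAxiomaticExtension RG.{u} fun Γ φ => RG.{u} (Γ ∪ S) φ := by
  have hRG := isLogic_RG.{u}
  refine ⟨⟨fun Γ φ h => hRG.refl _ _ (Or.inl h),
    fun Γ Δ φ h => hRG.mono _ _ _ (Set.union_subset_union_left S h), fun Γ Δ φ h => ?_,
    fun σ Γ φ h => ?_, fun Γ φ h => ?_⟩,
    fun Γ φ => hRG.mono _ _ _ Set.subset_union_left, S, hS, fun _ _ => Iff.rfl⟩
  · exact hRG.cut _ _ _ fun δ hδ => hδ.elim (h δ) fun hδ => hRG.refl _ _ (Or.inr hδ)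
  · refine hRG.mono _ _ _ ?_ (hRG.subst σ _ _ h)
    rintro _ ⟨ψ, hψ | hψ, rfl⟩
    · exact Or.inl ⟨ψ, hψ, rfl⟩
    · exact Or.inr (hS σ ψ hψ)
  · obtain ⟨Δ, hΔ, hfin, hh⟩ := hRG.finitary _ _ h
    refine ⟨Δ ∩ Γ, Set.inter_subset_right, hfin.subset Set.inter_subset_left,
      hRG.mono _ _ _ (fun δ hδ => ?_) hh⟩
    exact (hΔ hδ).imp_left fun h => ⟨hδ, h⟩

/-- The subvariety of the rational Gödel algebras in which the formulas of `S` are valid. -/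
def modelsOf (S : Set (Fm RatConst)) : Subvariety.{u} :=
  ⟨{A | A ∈ RGA ∧ A.Models (eqOne S)}, isVariety_models isVariety_RGA _, fun _ h => h.1⟩

/-- The subvariety of an axiomatic extension. -/
def AxExtension.toSubvariety (L : AxExtension.{u}) : Subvariety.{u} := modelsOf {φ | L.1 ∅ φ}

theorem AxExtension.mem_toSubvariety_iff {L : AxExtension.{u}} {S : Set (Fm RatConst)}
    (hS : SubstClosed S) (hL : ∀ Γ φ, L.1 Γ φ ↔ RG.{u} (Γ ∪ S) φ) {A : Alg.{u} RatConst} :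
    A ∈ L.toSubvariety.1 ↔ A ∈ RGA ∧ A.Models (eqOne S) := by
  refine and_congr_right fun hA => ⟨fun h => ?_, fun h => ?_⟩
  · rw [models_eqOne_iff] at *
    exact fun φ hφ => h φ ((hL _ _).2 (isLogic_RG.refl _ _ (Or.inr hφ)))
  · rw [models_eqOne_iff]
    intro φ hφ
    have hφ' : RG.{u} S φ := by
      rw [← Set.empty_union S]
      exact (hL _ _).1 hφ
    exact (RG_iff_forall_not_fails hS).1 hφ' A hA h

/-- Completeness applies to the axioms only: if each axiom of `L` is valid in the subvariety of
`L'`, it is derivable from the axioms of `L'`, and cut handles arbitrary premises. -/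
theorem AxExtension.toSubvariety_le_iff (L L' : AxExtension.{u}) :
    L'.toSubvariety ≤ L.toSubvariety ↔ L ≤ L' := by
  constructor
  · intro h Γ φ hφ
    obtain ⟨-, -, S, hS, hLS⟩ := L.2
    obtain ⟨-, -, S', hS', hLS'⟩ := L'.2
    refine (hLS' Γ φ).2 (isLogic_RG.cut _ _ _ ?_ ((hLS Γ φ).1 hφ))
    rintro δ (hδ | hδ)
    · exact isLogic_RG.refl _ _ (Or.inl hδ)
    · refine isLogic_RG.mono _ _ _ Set.subset_union_right
        ((RG_iff_forall_not_fails hS').2 fun A hA hAS => ?_)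
      have := h ((AxExtension.mem_toSubvariety_iff hS' hLS').2 ⟨hA, hAS⟩)
      exact models_eqOne_iff.1 ((AxExtension.mem_toSubvariety_iff hS hLS).1 this).2 δ hδ
  · rintro h A ⟨hA, hAL⟩
    refine ⟨hA, ?_⟩
    rw [models_eqOne_iff] at *
    exact fun φ hφ => hAL φ (h ∅ φ hφ)

theorem AxExtension.toSubvariety_injective :
    Function.Injective (AxExtension.toSubvariety : AxExtension.{u} → Subvariety.{u}) :=
  fun L L' h => le_antisymm ((AxExtension.toSubvariety_le_iff L L').1 h.ge)
    ((AxExtension.toSubvariety_le_iff L' L).1 h.le)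

/-- The formulas valid in `K` serve as axioms. They recover `K`, because each defining equation `s ≈
t` is encoded by `s ↔ t`. -/
theorem AxExtension.toSubvariety_surjective :
    Function.Surjective (AxExtension.toSubvariety : AxExtension.{u} → Subvariety.{u}) := by
  intro K
  let S : Set (Fm RatConst) := {φ | ∀ A ∈ K.1, ¬ Fails A φ.eqOne}
  have hS : SubstClosed S := fun σ φ hφ A hA hf => hφ A hA (fails_of_fails_subst hf)
  refine ⟨⟨_, isAxiomaticExtension_of_substClosed hS⟩, Subtype.ext (Set.ext fun A => ?_)⟩
  rw [AxExtension.mem_toSubvariety_iff hS fun _ _ => Iff.rfl, models_eqOne_iff]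
  refine ⟨fun ⟨hA, h⟩ => ?_, fun hA => ⟨K.2.2 hA, fun φ hφ => hφ A hA⟩⟩
  obtain ⟨K, ⟨E, rfl⟩, hR⟩ := K
  intro ε hε e
  by_contra hne
  refine h (Fm.iff ε.lhs ε.rhs) (fun B hB => ?_)
    ⟨e, fun hh => hne ((eval_iff_eq_one_iff hA e _ _).1 hh)⟩
  rintro ⟨e', he'⟩
  exact he' ((eval_iff_eq_one_iff (hR hB) e' _ _).2 (hB ε hε e'))

theorem substClosed_instances (T : Set (Fm RatConst)) :
    SubstClosed {ψ | ∃ σ : ℕ → Fm RatConst, ∃ χ ∈ T, ψ = χ.subst σ} := by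
  rintro τ _ ⟨σ, χ, hχ, rfl⟩
  refine ⟨fun n => (σ n).subst τ, χ, hχ, ?_⟩
  clear hχ
  induction χ <;> simp_all [Fm.subst]

/-- The axiomatic extension given by a set of formulas. -/
def axExtensionOf (T : Set (Fm RatConst)) : AxExtension.{u} :=
  ⟨addAxioms RG.{u} T, isAxiomaticExtension_of_substClosed (substClosed_instances T)⟩

theorem toSubvariety_axExtensionOf (T : Set (Fm RatConst)) :
    (axExtensionOf.{u} T).toSubvariety = modelsOf T := by
  refine Subtype.ext (Set.ext fun A => ?_)
  rw [AxExtension.mem_toSubvariety_iff (substClosed_instances T) fun _ _ => Iff.rfl]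
  refine and_congr_right fun _ => ?_
  rw [models_eqOne_iff, models_eqOne_iff]
  refine ⟨fun h φ hφ => h φ ⟨.var, φ, hφ, φ.subst_var.symm⟩, ?_⟩
  rintro h _ ⟨σ, χ, hχ, rfl⟩ hf
  exact h χ hχ (fails_of_fails_subst hf)

theorem addAxioms_addAxioms (T T' : Set (Fm RatConst)) :
    addAxioms (addAxioms RG.{u} T) T' = addAxioms RG.{u} (T ∪ T') := by
  funext Γ φ
  unfold addAxioms
  congr 1
  ext ψ
  constructor
  · rintro ((h | ⟨σ, χ, hχ, rfl⟩) | ⟨σ, χ, hχ, rfl⟩)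
    · exact Or.inl h
    · exact Or.inr ⟨σ, χ, Or.inr hχ, rfl⟩
    · exact Or.inr ⟨σ, χ, Or.inl hχ, rfl⟩
  · rintro (h | ⟨σ, χ, hχ | hχ, rfl⟩)
    · exact Or.inl (Or.inl h)
    · exact Or.inr ⟨σ, χ, hχ, rfl⟩
    · exact Or.inl (Or.inr ⟨σ, χ, hχ, rfl⟩)

theorem AxExtension.eq_addAxioms {L : AxExtension.{u}} {T : Set (Fm RatConst)}
    (h : L.toSubvariety.1 = {A | A ∈ RGA ∧ A.Models (eqOne T)}) : L.1 = addAxioms RG.{u} T :=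
  congrArg Subtype.val (AxExtension.toSubvariety_injective (a₁ := L) (a₂ := axExtensionOf T)
    ((Subtype.ext h).trans (toSubvariety_axExtensionOf T).symm))

theorem AxExtension.eq_of_isConsistent (L : AxExtension.{u}) (hL : IsConsistent L.1) :
    (∃ r : Set.Ioc (0 : ℝ) 1, L.1 = addAxioms RG.{u} (axQ r)) ∨
      (∃ p : Set.Ico (0 : ℚ) 1, L.1 = addAxioms RG.{u} (axQQ p)) ∨
      ∃ (p : Set.Ico (0 : ℚ) 1) (n : ℕ),
        L.1 = addAxioms (addAxioms RG.{u} (axQQ p)) {axHeight p n} := by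
  -- If the subvariety were trivial, every formula would be valid in it and hence, by completeness,
  -- a theorem.
  have hN : IsNontrivialClass L.toSubvariety.1 := by
    obtain ⟨-, -, S, hS, hLS⟩ := L.2
    obtain ⟨φ, hφ⟩ := hL
    by_contra hN
    refine hφ ((hLS _ _).2 (isLogic_RG.mono _ _ _ Set.subset_union_right
      ((RG_iff_forall_not_fails hS).2 fun A hA hAS => ?_)))
    exact models_iff_not_fails.1 (models_of_not_isNontrivialClass hN
      ((AxExtension.mem_toSubvariety_iff hS hLS).2 ⟨hA, hAS⟩) {φ.eqOne}) _ rfl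
  rcases eq_V_Q_or_eq_V_QQ L.toSubvariety.2.1 L.toSubvariety.2.2 hN with ⟨r, h⟩ | ⟨p, γ, h⟩
  · exact Or.inl ⟨r, AxExtension.eq_addAxioms (h.trans (V_Q_eq r))⟩
  · right
    induction γ using ENat.recTopCoe with
    | top => exact Or.inl ⟨p, AxExtension.eq_addAxioms (h.trans (V_QQ_top_eq p))⟩
    | coe n =>
      refine Or.inr ⟨p, n, ?_⟩
      rw [addAxioms_addAxioms]
      exact AxExtension.eq_addAxioms (h.trans (V_QQ_coe_eq p n))

/-- The axiomatic extensions of rational Gödel logic are dual to the subvarieties. -/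
noncomputable def axExtensionOrderIso : AxExtension.{u} ≃o Subvariety.{u}ᵒᵈ :=
  OrderIso.ofSurjective (OrderEmbedding.ofMapLEIff
    (fun L => OrderDual.toDual L.toSubvariety) fun L L' => AxExtension.toSubvariety_le_iff L L')
    fun K => AxExtension.toSubvariety_surjective (OrderDual.ofDual K)

end RatGodel

theorem theorem7p1 :
    -- the algebras `Q_r` and `Q_p^γ` are rational Gödel algebras
    ((∀ r, Q r ∈ RGA) ∧ (∀ p γ, QQ p γ ∈ RGA)) ∧
    -- classification of the nontrivial varieties, and axiomatizations
    (∀ K : Set (Alg.{u} RatConst), IsVariety K → K ⊆ RGA → IsNontrivialClass K →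
      (∃ r : Set.Ioc (0 : ℝ) 1, K = V {Q r}) ∨
        ∃ (p : Set.Ico (0 : ℚ) 1) (γ : ℕ∞), K = V {QQ p γ}) ∧
    (∀ r : Set.Ioc (0 : ℝ) 1,
      (V {Q r} : Set (Alg.{u} RatConst)) = {A | A ∈ RGA ∧ A.Models (eqOne (axQ r))}) ∧
    (∀ (p : Set.Ico (0 : ℚ) 1) (n : ℕ),
      (V {QQ p (n : ℕ∞)} : Set (Alg.{u} RatConst)) =
        {A | A ∈ RGA ∧ A.Models (eqOne (axQQ p ∪ {axHeight p n}))}) ∧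
    (∀ p : Set.Ico (0 : ℚ) 1,
      (V {QQ p ⊤} : Set (Alg.{u} RatConst)) = {A | A ∈ RGA ∧ A.Models (eqOne (axQQ p))}) ∧
    -- the inclusion order
    (∀ r₁ r₂ : Set.Ioc (0 : ℝ) 1,
      (V {Q r₁} : Set (Alg.{u} RatConst)) ⊆ V {Q r₂} ↔ r₁ ≤ r₂) ∧
    (∀ (r : Set.Ioc (0 : ℝ) 1) (p : Set.Ico (0 : ℚ) 1) (γ : ℕ∞),
      (V {Q r} : Set (Alg.{u} RatConst)) ⊆ V {QQ p γ} ↔ (r : ℝ) ≤ ((p : ℚ) : ℝ)) ∧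
    (∀ (r : Set.Ioc (0 : ℝ) 1) (p : Set.Ico (0 : ℚ) 1) (γ : ℕ∞),
      (V {QQ p γ} : Set (Alg.{u} RatConst)) ⊆ V {Q r} ↔ ((p : ℚ) : ℝ) < (r : ℝ)) ∧
    (∀ (p₁ p₂ : Set.Ico (0 : ℚ) 1) (γ₁ γ₂ : ℕ∞),
      (V {QQ p₁ γ₁} : Set (Alg.{u} RatConst)) ⊆ V {QQ p₂ γ₂} ↔
        p₁ < p₂ ∨ (p₁ = p₂ ∧ γ₁ ≤ γ₂)) ∧
    -- the lattice of subvarieties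
    ((∀ K₁ K₂ : Subvariety.{u}, K₁ ≤ K₂ ∨ K₂ ≤ K₁) ∧ Uncountable Subvariety.{u} ∧
      Nonempty (Subvariety.{u} ≃o WithBot (DedekindCut LexPoset))) ∧
    -- the consistent axiomatic extensions of rational Gödel logic
    (∀ L : Entailment, IsAxiomaticExtension RG.{u} L → IsConsistent L →
      (∃ r : Set.Ioc (0 : ℝ) 1, L = addAxioms RG.{u} (axQ r)) ∨
      (∃ p : Set.Ico (0 : ℚ) 1, L = addAxioms RG.{u} (axQQ p)) ∨
      ∃ (p : Set.Ico (0 : ℚ) 1) (n : ℕ),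
        L = addAxioms (addAxioms RG.{u} (axQQ p)) {axHeight p n}) ∧
    -- the lattice of axiomatic extensions of rational Gödel logic
    ((∀ L₁ L₂ : AxExtension.{u}, L₁ ≤ L₂ ∨ L₂ ≤ L₁) ∧ Uncountable AxExtension.{u} ∧
      Nonempty (AxExtension.{u} ≃o (WithBot (DedekindCut LexPoset))ᵒᵈ)) := by
  refine ⟨⟨Q_mem_RGA, QQ_mem_RGA⟩, fun K => eq_V_Q_or_eq_V_QQ, V_Q_eq, V_QQ_coe_eq, V_QQ_top_eq,
    fun _ _ => V_Q_subset_V_Q, fun _ _ _ => V_Q_subset_V_QQ, fun _ _ _ => V_QQ_subset_V_Q,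
    fun _ _ _ _ => V_QQ_subset_V_QQ,
    ⟨Subvariety.le_total, uncountable_subvariety, nonempty_orderIso_subvariety⟩,
    fun L hL hC => AxExtension.eq_of_isConsistent ⟨L, hL⟩ hC, fun L₁ L₂ => ?_, ?_, ?_⟩
  · rw [← AxExtension.toSubvariety_le_iff, ← AxExtension.toSubvariety_le_iff]
    exact Subvariety.le_total _ _
  · have := uncountable_subvariety.{u}
    exact AxExtension.toSubvariety_surjective.uncountable
  · obtain ⟨f⟩ := nonempty_orderIso_subvariety.{u}
    exact ⟨axExtensionOrderIso.trans f.dual⟩
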